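/- Let $\lambda>0$, $p,q\in[0,1]$, and let $\phi:\mathbb{R}_+\to[0,1]$ be measurable. Let $S$ be the one-dimensional torus $(-\frac12,\frac12]$ with metric $d(x,y)=\min\{|x-y|,1-|x-y|\}$. For each integer $n\ge 1$ the geometric kernel block model $\mathrm{GKBM}(\lambda n,p,q,\phi)$ is the following random triple $(\sigma^{(n)},X^{(n)},A^{(n)})$. The number of nodes $N$ is Poisson with mean $\lambda n$. Given $N$, the community labels $\sigma(1),\dots,\sigma(N)$ are independent and uniform on $\{-1,+1\}$, and, independently of them, the locations $X_1,\dots,X_N$ are independent and uniform on $S$. Given labels and locations, each unordered pair $\{u,v\}$ of distinct nodes is linked, independently over the pairs, with probability $p\,\phi\!\left(\frac{n}{\log n}d(X_u,X_v)\right)$ if $\sigma(u)=\sigma(v)$ and $q\,\phi\!\left(\frac{n}{\log n}d(X_u,X_v)\right)$ if $\sigma(u)\neq\sigma(v)$; $A^{(n)}$ is the adjacency matrix of the resulting graph. Put $$I_\phi(p,q)=2\int_0^\infty\Big(1-\sqrt{pq}\,\phi(x)-\sqrt{(1-p\phi(x))(1-q\phi(x))}\Big)\,dx,\qquad \kappa=\sup\{x\ge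 0:\phi(x)\neq 0\},$$ and assume that $0<\kappa<\infty$. If $\lambda\kappa<1$ or $\lambda I_\phi(p,q)<1$, then no estimator recovers the communities exactly: there is no sequence of estimators $\tilde\sigma^{(n)}=\tilde\sigma^{(n)}(A^{(n)},X^{(n)})$, i.e. (measurable) functions of the adjacency matrix and the locations only, with $$\lim_{n\to\infty}\mathbb{P}\big(\tilde\sigma^{(n)}\in\{\sigma^{(n)},-\sigma^{(n)}\}\big)=1 .$$ -/

import Mathlib

open MeasureTheory ProbabilityTheory Filter Topology
open scoped NNReal ENNReal

noncomputable section

namespace GKBM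

/-- The one-dimensional torus of circumference one: the circle `ℝ / ℤ` with its quotient metric
and its normalised Haar measure. -/
abbrev Torus : Type := UnitAddCircle

/-- In the coordinates `(-1/2, 1/2]`, the metric of the torus is
`d(x, y) = min {|x - y|, 1 - |x - y|}`. -/
theorem torus_dist_eq {x y : ℝ} (hx : x ∈ Set.Ioc (-1 / 2 : ℝ) (1 / 2))
    (hy : y ∈ Set.Ioc (-1 / 2 : ℝ) (1 / 2)) :
    dist (x : Torus) (y : Torus) = min |x - y| (1 - |x - y|) := by
  obtain ⟨hx1, hx2⟩ := hx
  obtain ⟨hy1, hy2⟩ := hy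
  have h1 : |x - y| < 1 := by rw [abs_lt]; constructor <;> linarith
  rw [dist_eq_norm, ← AddCircle.coe_sub, UnitAddCircle.norm_eq, abs_sub_round_eq_min]
  rcases le_or_gt 0 (x - y) with h | h
  · rw [abs_of_nonneg h] at h1 ⊢
    rw [Int.fract_eq_self.2 ⟨h, h1⟩]
  · rw [abs_of_neg h] at h1 ⊢
    have h2 : Int.fract (x - y) = x - y + 1 := by
      rw [Int.fract_eq_iff]
      exact ⟨by linarith, by linarith, -1, by push_cast; ring⟩
    rw [h2, min_comm]
    congr 1 <;> ring

/-- Realisations of the model with `N` nodes: the community labels in `{-1, +1}`, the locations,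
and the undirected graph. -/
abbrev Config (N : ℕ) : Type := (Fin N → ℤˣ) × (Fin N → Torus) × SimpleGraph (Fin N)

/-- The scaled kernel `ψ_n(x, y) = φ ((n / log n) d(x, y))`. -/
def psi (φ : ℝ≥0 → ℝ) (n : ℕ) (x y : Torus) : ℝ :=
  φ (Real.toNNReal ((n : ℝ) / Real.log n * dist x y))

/-- The conditional probability, given labels and locations, that the nodes `u` and `v` are
linked. -/
def linkProb (p q : ℝ) (φ : ℝ≥0 → ℝ) (n : ℕ) {N : ℕ} (σ : Fin N → ℤˣ) (X : Fin N → Torus)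
    (u v : Fin N) : ℝ :=
  (if σ u = σ v then p else q) * psi φ n (X u) (X v)

open Classical in
/-- The conditional probability of the graph given labels and locations: each node pair `u < v`
is linked independently with probability `linkProb`. -/
def graphProb (p q : ℝ) (φ : ℝ≥0 → ℝ) (n : ℕ) {N : ℕ} (ω : Config N) : ℝ≥0∞ :=
  ∏ e : Fin N × Fin N with e.1 < e.2,
    if ω.2.2.Adj e.1 e.2 then ENNReal.ofReal (linkProb p q φ n ω.1 ω.2.1 e.1 e.2)
    else ENNReal.ofReal (1 - linkProb p q φ n ω.1 ω.2.1 e.1 e.2)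

/-- The law of labels, locations and graph given that there are `N` nodes: the labels are
independent and uniform on `{-1, +1}`, the locations are independent and uniform on the torus, and
the graph has the conditional probability mass function `graphProb`. -/
def condLaw (p q : ℝ) (φ : ℝ≥0 → ℝ) (n N : ℕ) : Measure (Config N) :=
  ((Measure.pi fun _ : Fin N => uniformOn (Set.univ : Set ℤˣ)).prod
    ((Measure.pi fun _ : Fin N => (volume : Measure Torus)).prod
      (Measure.count : Measure (SimpleGraph (Fin N))))).withDensity (graphProb p q φ n)

/-- The law of `GKBM(λ n, p, q, φ)`: the number of nodes `N` is Poisson with mean `λ n`, and given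
`N` the labels, locations and graph have law `condLaw`. -/
def law (lam : ℝ≥0) (p q : ℝ) (φ : ℝ≥0 → ℝ) (n : ℕ) : Measure (Σ N : ℕ, Config N) :=
  Measure.sum fun N =>
    poissonMeasure (lam * n) {N} • (condLaw p q φ n N).map (Sigma.mk N)

/-- An estimator assigns a labelling of the nodes to the locations and the graph, measurably. -/
structure Estimator where
  /-- The estimated labels. -/
  est : ∀ N : ℕ, (Fin N → Torus) → SimpleGraph (Fin N) → Fin N → ℤˣ
  measurable_est : ∀ N : ℕ,
    Measurable fun XG : (Fin N → Torus) × SimpleGraph (Fin N) => est N XG.1 XG.2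

/-- The event that the estimate equals the true labelling up to a global change of sign. -/
def Estimator.success (T : Estimator) : Set (Σ N : ℕ, Config N) :=
  {ω | T.est ω.1 ω.2.2.1 ω.2.2.2 = ω.2.1 ∨ T.est ω.1 ω.2.2.1 ω.2.2.2 = -ω.2.1}

/-- A sequence of estimators recovers the community structure exactly if the probability of the
success event tends to one. -/
def RecoversExactly (lam : ℝ≥0) (p q : ℝ) (φ : ℝ≥0 → ℝ) (T : ℕ → Estimator) : Prop :=
  Tendsto (fun n : ℕ => law lam p q φ n (T n).success) atTop (𝓝 1)

/-- The information metric `I_φ(p, q)`. -/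
def infoMetric (φ : ℝ≥0 → ℝ) (p q : ℝ) : ℝ :=
  2 * ∫ x in Set.Ioi (0 : ℝ),
    (1 - √(p * q) * φ x.toNNReal - √((1 - p * φ x.toNNReal) * (1 - q * φ x.toNNReal)))

/-- The normalised interaction range `κ = sup {x : φ x ≠ 0}`, possibly infinite. -/
def interactionRange (φ : ℝ≥0 → ℝ) : ℝ≥0∞ :=
  ⨆ x ∈ {x : ℝ≥0 | φ x ≠ 0}, (x : ℝ≥0∞)

end GKBM

end

/-! The labels are uniform, so given the graph and the locations a labelling is as probable as its
likelihood dictates. Call a labelling other than the truth and its negative a rival if it is at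
least as likely as the truth. For a fixed graph an estimator is right on at most two labellings.
Each of these that has a rival weighs no more than everything outside the pair, so the success
probability is at most (2 + ρ)/3, where ρ is the probability that there is no rival
(`sum_success_le`, `condLaw_success_le`). It suffices that ρ tends to zero in mean, because then
success stays below 5/6.

Rivals come from isolated nodes. Let H be a sum of isolation weights ∏ g(X_i, X_j) over the nodes in
a set C, where ∫ (1 - g) = α ≤ a log n / n. If two nodes of positive weight have disjoint
neighbourhoods, then E H² ≤ E H + (1 + o(1)) (E H)². For c₁n ≤ N ≤ c₂n the mean of H is at least of
order n^(1 - b) for any fixed b above c₂a and large n, and c₂ may be any number above λ. If λa < 1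
the mean diverges and H concentrates. Once ρ H ≤ D for a constant D, ρ tends to zero in mean. This
is `not_recoversExactly_of_isolation`; Chernoff bounds dispose of the N outside the window.

Case λκ < 1: g is the indicator of an empty arc of length κ log n / n ahead of a node, so a = κ. Two
such gaps cut the circle into two arcs without links between them; flipping one arc leaves the
likelihood unchanged, so ρ = 0 as soon as H > 1.

Case λI < 1: flip a single label. Flipping node i does not hurt with probability at least a constant
times the product over its neighbours of (affinity - δ), where affinity is the Bhattacharyya
coefficient of the two link laws. With that product as isolation weight, a exceeds I by as little as
desired. For nodes more than twice the range apart these events are independent, so ρ ≤ ∏ (1 - c hᵢ)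
≤ exp(-cH) and ρ H ≤ 1/c. The lower bound on the flip probability replaces a Cramér estimate; it
comes from `tilt`, a minorant of the minimum of two likelihoods that is almost multiplicative over
independent links (`tilt_le_min`, `tilt_mul_add_tilt_mul`). -/

namespace GKBM

/-! ### A nearly multiplicative lower bound for the minimum of two likelihoods -/

section Tilt

/-- The geometric mean of `u` and `v`, damped by a Gaussian factor in their log-ratio. -/
noncomputable def tilt (K u v : ℝ) : ℝ :=
  √(u * v) * Real.exp (-(Real.log u - Real.log v) ^ 2 / (4 * K))

theorem tilt_nonneg (K u v : ℝ) : 0 ≤ tilt K u v := by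
  unfold tilt; positivity

theorem tilt_one_one (K : ℝ) : tilt K 1 1 = 1 := by
  simp [tilt]

theorem tilt_zero_left (K v : ℝ) : tilt K 0 v = 0 := by
  simp [tilt]

theorem tilt_zero_right (K u : ℝ) : tilt K u 0 = 0 := by
  simp [tilt]

theorem sqrt_mul_eq_exp_log {a b : ℝ} (ha : 0 < a) (hb : 0 < b) :
    √(a * b) = Real.exp ((Real.log a + Real.log b) / 2) := by
  rw [← Real.log_mul ha.ne' hb.ne', Real.exp_half, Real.exp_log (mul_pos ha hb)]

/-- Both logarithms are nonpositive, so the squared difference is at most the squared sum, and `w ≤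
exp w` at `w = -(log a + log b) / 4` absorbs that into `1 / √(a * b)`. At a zero argument the root
vanishes, whatever value `Real.log` takes there. -/
theorem sqrt_mul_log_sub_sq_le {a b : ℝ} (ha : a ∈ Set.Icc (0 : ℝ) 1)
    (hb : b ∈ Set.Icc (0 : ℝ) 1) : √(a * b) * (Real.log a - Real.log b) ^ 2 ≤ 16 := by
  rcases ha.1.eq_or_lt with rfl | ha0
  · simp
  rcases hb.1.eq_or_lt with rfl | hb0
  · simp
  rw [sqrt_mul_eq_exp_log ha0 hb0]
  have hx := Real.log_nonpos ha.1 ha.2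
  have hy := Real.log_nonpos hb.1 hb.2
  set x := Real.log a
  set y := Real.log b
  have h1 := Real.add_one_le_exp (-(x + y) / 4)
  have h2 : (-(x + y) / 4) ^ 2 ≤ Real.exp (-(x + y) / 4) ^ 2 :=
    pow_le_pow_left₀ (by linarith) (by linarith) 2
  have h3 : Real.exp (-(x + y) / 4) ^ 2 = Real.exp (-((x + y) / 2)) := by
    rw [← Real.exp_nat_mul]; congr 1; push_cast; ring
  have h4 : Real.exp ((x + y) / 2) * Real.exp (-((x + y) / 2)) = 1 := by
    rw [← Real.exp_add]; simp
  have h5 : (x - y) ^ 2 ≤ (x + y) ^ 2 := by nlinarith [mul_nonneg_of_nonpos_of_nonpos hx hy]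
  have h6 : (x - y) ^ 2 ≤ 16 * Real.exp (-((x + y) / 2)) := by rw [← h3]; nlinarith
  nlinarith [Real.exp_pos ((x + y) / 2)]

/-- With z the log-ratio, the minimum equals √(uv) exp(-|z|/2), and completing the square in (|z| -
K)² gives |z|/2 ≤ K/4 + z²/(4K). -/
theorem tilt_le_min {K u v : ℝ} (hK : 0 < K) (hu : 0 ≤ u) (hv : 0 ≤ v) :
    Real.exp (-K / 4) * tilt K u v ≤ min u v := by
  rcases hu.eq_or_lt with rfl | hu
  · simp [tilt_zero_left, hv]
  rcases hv.eq_or_lt with rfl | hv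
  · simp [tilt_zero_right, hu.le]
  rw [tilt, sqrt_mul_eq_exp_log hu hv, ← Real.exp_add, ← Real.exp_add]
  have key : ∀ z : ℝ, -K / 4 - z ^ 2 / (4 * K) ≤ -(|z| / 2) := by
    intro z
    have h : 0 ≤ (|z| - K) ^ 2 / (4 * K) := by positivity
    have h' : (|z| - K) ^ 2 / (4 * K) = z ^ 2 / (4 * K) - |z| / 2 + K / 4 := by
      rw [sub_sq, sq_abs]; field_simp; ring
    linarith
  have := key (Real.log u - Real.log v)
  have e1 : -(Real.log u - Real.log v) ^ 2 / (4 * K) = -((Real.log u - Real.log v) ^ 2 / (4 * K)) :=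
    neg_div _ _
  refine le_min ?_ ?_
  · rw [← Real.le_log_iff_exp_le hu]
    have := neg_abs_le (Real.log u - Real.log v)
    linarith
  · rw [← Real.le_log_iff_exp_le hv]
    have := le_abs_self (Real.log u - Real.log v)
    linarith

/-- After factoring out exp A, apply `1 + t ≤ exp t` to both terms; the cross terms ± xz/(2K)
cancel. -/
theorem two_le_exp_add_exp (A z K : ℝ) (hK : 0 < K) (x : ℝ) (hA : A = -x ^ 2 / (4 * K)) :
    2 * Real.exp A * (1 - z ^ 2 / (4 * K)) ≤
      Real.exp (-(x + z) ^ 2 / (4 * K)) + Real.exp (-(x - z) ^ 2 / (4 * K)) := by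
  have e1 : -(x + z) ^ 2 / (4 * K) = A + (-(z ^ 2 / (4 * K)) - x * z / (2 * K)) := by
    rw [hA]; field_simp; ring
  have e2 : -(x - z) ^ 2 / (4 * K) = A + (-(z ^ 2 / (4 * K)) + x * z / (2 * K)) := by
    rw [hA]; field_simp; ring
  rw [e1, e2, Real.exp_add, Real.exp_add]
  have h1 := Real.add_one_le_exp (-(z ^ 2 / (4 * K)) - x * z / (2 * K))
  have h2 := Real.add_one_le_exp (-(z ^ 2 / (4 * K)) + x * z / (2 * K))
  nlinarith [Real.exp_pos A]

/-- One more observation moves the log-ratio by ± z with equal weight. By symmetry the first-order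
effect on the Gaussian factor cancels, and the second-order loss √(ab) z²/(4K) is at most 16/(4K) =
4/K uniformly in a and b. This uniformity is what the Gaussian damping buys. -/
theorem tilt_mul_add_tilt_mul {K u v a b : ℝ} (hK : 0 < K) (hu : 0 ≤ u) (hv : 0 ≤ v)
    (ha : a ∈ Set.Icc (0 : ℝ) 1) (hb : b ∈ Set.Icc (0 : ℝ) 1) :
    2 * tilt K u v * (√(a * b) - 4 / K) ≤
      tilt K (u * a) (v * b) + tilt K (u * b) (v * a) := by
  have h4 : 0 < 4 / K := by positivity
  have hsum : 0 ≤ tilt K (u * a) (v * b) + tilt K (u * b) (v * a) :=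
    add_nonneg (tilt_nonneg _ _ _) (tilt_nonneg _ _ _)
  rcases hu.eq_or_lt with rfl | hu
  · simp [tilt_zero_left]
  rcases hv.eq_or_lt with rfl | hv
  · simp [tilt_zero_right]
  -- If a or b is zero the logarithms are meaningless, but the left side is then nonpositive.
  have hneg : √(a * b) = 0 → 2 * tilt K u v * (√(a * b) - 4 / K) ≤
      tilt K (u * a) (v * b) + tilt K (u * b) (v * a) := by
    intro h0
    rw [h0]
    nlinarith [tilt_nonneg K u v]
  rcases ha.1.eq_or_lt with h0 | ha0
  · exact hneg (by rw [← h0]; simp)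
  rcases hb.1.eq_or_lt with h0 | hb0
  · exact hneg (by rw [← h0]; simp)
  have hab := sqrt_mul_log_sub_sq_le ha hb
  have e1 : √(u * a * (v * b)) = √(u * v) * √(a * b) := by
    rw [← Real.sqrt_mul (by positivity)]; congr 1; ring
  have e2 : √(u * b * (v * a)) = √(u * v) * √(a * b) := by
    rw [← Real.sqrt_mul (by positivity)]; congr 1; ring
  have l1 : Real.log (u * a) - Real.log (v * b) =
      (Real.log u - Real.log v) + (Real.log a - Real.log b) := by
    rw [Real.log_mul hu.ne' ha0.ne', Real.log_mul hv.ne' hb0.ne']; ring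
  have l2 : Real.log (u * b) - Real.log (v * a) =
      (Real.log u - Real.log v) - (Real.log a - Real.log b) := by
    rw [Real.log_mul hu.ne' hb0.ne', Real.log_mul hv.ne' ha0.ne']; ring
  have key := two_le_exp_add_exp _ (Real.log a - Real.log b) K hK (Real.log u - Real.log v) rfl
  unfold tilt
  rw [e1, e2, l1, l2]
  set s := √(a * b)
  set E := Real.exp (-(Real.log u - Real.log v) ^ 2 / (4 * K))
  set z := Real.log a - Real.log b
  have hs : 0 ≤ s := Real.sqrt_nonneg _
  have hr : 0 ≤ √(u * v) := Real.sqrt_nonneg _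
  have hE : 0 < E := Real.exp_pos _
  have h5 : s - 4 / K ≤ s * (1 - z ^ 2 / (4 * K)) := by
    have : s * z ^ 2 / (4 * K) ≤ 16 / (4 * K) := by gcongr
    have e : (16 : ℝ) / (4 * K) = 4 / K := by field_simp; norm_num
    have e' : s * (1 - z ^ 2 / (4 * K)) = s - s * z ^ 2 / (4 * K) := by ring
    rw [e', ← e]; linarith
  calc 2 * (√(u * v) * E) * (s - 4 / K) ≤ 2 * (√(u * v) * E) * (s * (1 - z ^ 2 / (4 * K))) := by
        gcongr
    _ = √(u * v) * s * (2 * E * (1 - z ^ 2 / (4 * K))) := by ring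
    _ ≤ √(u * v) * s * _ := mul_le_mul_of_nonneg_left key (by positivity)
    _ = _ := by ring

end Tilt

/-! ### Sums over finite product spaces -/

section FiniteProducts

/-- A one-coordinate lower bound propagates multiplicatively to a product space. -/
theorem prod_mul_le_sum_pi {ι κ : Type*} [Fintype ι] [DecidableEq ι] [Fintype κ]
    (F : ℝ → ℝ → ℝ) (a b : ι → κ → ℝ) (c : ι → ℝ) (ha : ∀ j k, 0 ≤ a j k)
    (hb : ∀ j k, 0 ≤ b j k) (hc : ∀ j, 0 ≤ c j)
    (hF : ∀ j u v, 0 ≤ u → 0 ≤ v → c j * F u v ≤ ∑ k, F (u * a j k) (v * b j k))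
    {u v : ℝ} (hu : 0 ≤ u) (hv : 0 ≤ v) :
    (∏ j, c j) * F u v ≤ ∑ x : ι → κ, F (u * ∏ j, a j (x j)) (v * ∏ j, b j (x j)) := by
  -- Induction on the number of coordinates. The first factor is absorbed into u and v, which is why
  -- the one-coordinate bound is required at all nonnegative u, v.
  have main : ∀ (n : ℕ) (a b : Fin n → κ → ℝ) (c : Fin n → ℝ), (∀ j k, 0 ≤ a j k) →
      (∀ j k, 0 ≤ b j k) → (∀ j, 0 ≤ c j) →
      (∀ j u v, 0 ≤ u → 0 ≤ v → c j * F u v ≤ ∑ k, F (u * a j k) (v * b j k)) →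
      ∀ u v : ℝ, 0 ≤ u → 0 ≤ v →
      (∏ j, c j) * F u v ≤ ∑ x : Fin n → κ, F (u * ∏ j, a j (x j)) (v * ∏ j, b j (x j)) := by
    intro n
    induction n with
    | zero => intro a b c _ _ _ _ u v _ _; simp
    | succ n ih =>
      intro a b c ha hb hc hF u v hu hv
      rw [Fin.prod_univ_succ]
      have e := Fintype.sum_equiv (Fin.consEquiv fun _ : Fin (n + 1) => κ)
        (fun p => F (u * a 0 p.1 * ∏ j : Fin n, a j.succ (p.2 j))
          (v * b 0 p.1 * ∏ j : Fin n, b j.succ (p.2 j)))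
        (fun x => F (u * ∏ j, a j (x j)) (v * ∏ j, b j (x j)))
        (by intro p; simp [Fin.prod_univ_succ, Fin.consEquiv, mul_assoc])
      rw [← e, Fintype.sum_prod_type]
      calc c 0 * (∏ j : Fin n, c j.succ) * F u v
          = (∏ j : Fin n, c j.succ) * (c 0 * F u v) := by ring
        _ ≤ (∏ j : Fin n, c j.succ) * ∑ k, F (u * a 0 k) (v * b 0 k) :=
            mul_le_mul_of_nonneg_left (hF 0 u v hu hv) (Finset.prod_nonneg fun j _ => hc _)
        _ = ∑ k, (∏ j : Fin n, c j.succ) * F (u * a 0 k) (v * b 0 k) := Finset.mul_sum _ _ _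
        _ ≤ _ := Finset.sum_le_sum fun k _ =>
            ih _ _ _ (fun j => ha _) (fun j => hb _) (fun j => hc _) (fun j => hF _) _ _
              (mul_nonneg hu (ha _ _)) (mul_nonneg hv (hb _ _))
  let e := (Fintype.equivFin ι).symm
  have h := main (Fintype.card ι) (fun j => a (e j)) (fun j => b (e j)) (fun j => c (e j))
    (fun j => ha _) (fun j => hb _) (fun j => hc _) (fun j => hF _) u v hu hv
  rw [e.prod_comp c] at h
  refine h.trans (le_of_eq ?_)
  refine Fintype.sum_equiv (Equiv.arrowCongr e (Equiv.refl κ)) _ _ fun x => ?_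
  congr 2
  · rw [← e.prod_comp]; simp
  · rw [← e.prod_comp]; simp

/-- Under a product weight, functions of disjoint blocks of coordinates are independent. -/
theorem sum_pi_prod_blocks {ι β C : Type*} [Fintype ι] [DecidableEq ι] [Fintype β]
    [Fintype C] [DecidableEq C] {A : C → Type*} [∀ i, Fintype (A i)] [∀ i, DecidableEq (A i)]
    (a : ι → β → ℝ) (ha : ∀ e, ∑ z, a e z = 1) (m : (Σ i, A i) → ι)
    (hm : Function.Injective m) (f : ∀ i, (A i → β) → ℝ) :
    ∑ y : ι → β, (∏ e, a e (y e)) * ∏ i, f i (fun j => y (m ⟨i, j⟩)) =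
      ∏ i, ∑ z : A i → β, (∏ j, a (m ⟨i, j⟩) (z j)) * f i z := by
  classical
  -- Split the coordinates into those used by some block and the rest; the rest sum to one.
  let eD : (Σ i, A i) ≃ {e : ι // e ∈ Set.range m} := Equiv.ofInjective m hm
  let E := Equiv.piEquivPiSubtypeProd (fun e : ι => e ∈ Set.range m) (fun _ => β)
  have step1 : ∑ y : ι → β, (∏ e, a e (y e)) * ∏ i, f i (fun j => y (m ⟨i, j⟩)) =
      ∑ p : ({e : ι // e ∈ Set.range m} → β) × ({e : ι // e ∉ Set.range m} → β),
        ((∏ e, a e.1 (p.1 e)) * ∏ i, f i (fun j => p.1 (eD ⟨i, j⟩))) *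
          ∏ e, a e.1 (p.2 e) := by
    refine Fintype.sum_equiv E _ _ fun y => ?_
    have h := Fintype.prod_subtype_mul_prod_subtype (fun e : ι => e ∈ Set.range m)
      (fun e => a e (y e))
    rw [← h]
    simp only [E, Equiv.piEquivPiSubtypeProd, Equiv.coe_fn_mk, eD, Equiv.ofInjective_apply]
    rw [mul_right_comm]
    congr!
  have step2 : ∑ y : {e : ι // e ∉ Set.range m} → β, ∏ e, a e.1 (y e) = 1 := by
    rw [← Fintype.piFinset_univ, ← Finset.prod_univ_sum]
    simp [ha]
  rw [step1, Fintype.sum_prod_type]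
  simp_rw [← Finset.mul_sum, step2, mul_one]
  have step3 : ∑ y : {e : ι // e ∈ Set.range m} → β,
      (∏ e, a e.1 (y e)) * ∏ i, f i (fun j => y (eD ⟨i, j⟩)) =
      ∑ y : ∀ i, A i → β, ∏ i, ((∏ j, a (m ⟨i, j⟩) (y i j)) * f i (y i)) := by
    refine Fintype.sum_equiv ((Equiv.arrowCongr eD.symm (Equiv.refl β)).trans
      (Equiv.piCurry fun _ _ => β)) _ _ fun y => ?_
    rw [Finset.prod_mul_distrib, ← eD.prod_comp, Fintype.prod_sigma]
    congr 1
  rw [step3, ← Fintype.piFinset_univ]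
  exact (Finset.prod_univ_sum (fun _ => Finset.univ)
    (fun i (z : A i → β) => (∏ j, a (m ⟨i, j⟩) (z j)) * f i z)).symm

end FiniteProducts

/-! ### One node and its neighbours: the chance that a flip is harmless -/

section Block

variable {A : Type*} [Fintype A] [DecidableEq A]

/-- The Bhattacharyya coefficient of the two link distributions. -/
noncomputable def affinity (s t : ℝ) : ℝ := √(s * t) + √((1 - s) * (1 - t))

theorem affinity_comm (s t : ℝ) : affinity s t = affinity t s := by
  simp [affinity, mul_comm]

/-- The probability weight of a link indicator. -/
def linkWeight (s : ℝ) (z : Bool) : ℝ := if z then s else 1 - s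

theorem linkWeight_mem {s : ℝ} (hs : s ∈ Set.Icc (0 : ℝ) 1) (z : Bool) :
    linkWeight s z ∈ Set.Icc (0 : ℝ) 1 := by
  obtain ⟨h1, h2⟩ := hs
  cases z <;> simp [linkWeight] <;> constructor <;> linarith

theorem sum_linkWeight (s : ℝ) : ∑ z, linkWeight s z = 1 := by
  simp [linkWeight]

theorem sum_units_bool (f : ℤˣ → Bool → ℝ) :
    ∑ k : ℤˣ × Bool, f k.1 k.2 = f 1 true + f 1 false + (f (-1) true + f (-1) false) := by
  rw [Fintype.sum_prod_type, UnitsInt.univ]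
  simp

/-- Replace the minimum by `tilt` and sum out one neighbour at a time, over its sign and its link.
Each of the two link values loses 4/K, hence the total loss 8/K; the maximum with 0 keeps the
factors nonnegative so that they can be multiplied. -/
theorem two_pow_mul_prod_le_sum_min {K : ℝ} (hK : 0 < K) (r : A → ℤˣ → ℝ)
    (hr : ∀ j τ, r j τ ∈ Set.Icc (0 : ℝ) 1) :
    Real.exp (-K / 4) * 2 ^ Fintype.card A *
        ∏ j, max 0 (affinity (r j 1) (r j (-1)) - 8 / K) ≤
      ∑ s : A → ℤˣ, ∑ z : A → Bool, min (∏ j, linkWeight (r j (s j)) (z j))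
        (∏ j, linkWeight (r j (-s j)) (z j)) := by
  have hw : ∀ j τ z, linkWeight (r j τ) z ∈ Set.Icc (0 : ℝ) 1 :=
    fun j τ z => linkWeight_mem (hr j τ) z
  have h := prod_mul_le_sum_pi (tilt K)
    (fun (j : A) (k : ℤˣ × Bool) => linkWeight (r j k.1) k.2)
    (fun (j : A) (k : ℤˣ × Bool) => linkWeight (r j (-k.1)) k.2)
    (fun j => 2 * max 0 (affinity (r j 1) (r j (-1)) - 8 / K))
    (fun j k => (hw _ _ _).1) (fun j k => (hw _ _ _).1) (fun j => by positivity) ?_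
    zero_le_one zero_le_one
  · rw [tilt_one_one, mul_one, Finset.prod_mul_distrib, Finset.prod_const, Finset.card_univ] at h
    simp only [one_mul] at h
    rw [mul_assoc]
    refine (mul_le_mul_of_nonneg_left h (Real.exp_pos _).le).trans ?_
    rw [Finset.mul_sum, ← Fintype.sum_prod_type'
      (f := fun (s : A → ℤˣ) (z : A → Bool) => min (∏ j, linkWeight (r j (s j)) (z j))
        (∏ j, linkWeight (r j (-s j)) (z j)))]
    refine (Finset.sum_le_sum fun x _ => tilt_le_min hK (Finset.prod_nonneg fun j _ => (hw _ _ _).1)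
      (Finset.prod_nonneg fun j _ => (hw _ _ _).1)).trans (le_of_eq ?_)
    exact Fintype.sum_equiv (Equiv.arrowProdEquivProdArrow A (fun _ => ℤˣ) (fun _ => Bool)) _ _
      fun x => rfl
  · intro j u v hu hv
    rw [sum_units_bool (fun τ z => tilt K (u * linkWeight (r j τ) z) (v * linkWeight (r j (-τ)) z))]
    have h1 := tilt_mul_add_tilt_mul hK hu hv (hw j 1 true) (hw j (-1) true)
    have h2 := tilt_mul_add_tilt_mul hK hu hv (hw j 1 false) (hw j (-1) false)
    have h0 : ∀ τ z, 0 ≤ tilt K (u * linkWeight (r j τ) z) (v * linkWeight (r j (-τ)) z) :=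
      fun τ z => tilt_nonneg _ _ _
    have n1 := h0 1 true
    have n2 := h0 1 false
    have n3 := h0 (-1) true
    have n4 := h0 (-1) false
    simp only [neg_neg] at n1 n2 n3 n4 h1 h2 ⊢
    rcases le_total 0 (affinity (r j 1) (r j (-1)) - 8 / K) with hp | hp
    · rw [max_eq_right hp]
      have e : affinity (r j 1) (r j (-1)) - 8 / K =
          (√(linkWeight (r j 1) true * linkWeight (r j (-1)) true) - 4 / K) +
          (√(linkWeight (r j 1) false * linkWeight (r j (-1)) false) - 4 / K) := by
        simp [affinity, linkWeight]; ring
      rw [e]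
      linarith
    · rw [max_eq_left hp]
      linarith

/-- With uniform signs, the label-flipped link pattern is at least as likely with a probability
bounded below by a product over the block. -/
theorem le_sum_flip_likely {K : ℝ} (hK : 0 < K) (r : A → ℤˣ → ℝ)
    (hr : ∀ j τ, r j τ ∈ Set.Icc (0 : ℝ) 1) :
    Real.exp (-K / 4) / 2 * 2 ^ Fintype.card A *
        ∏ j, max 0 (affinity (r j 1) (r j (-1)) - 8 / K) ≤
      ∑ s : A → ℤˣ, ∑ z : A → Bool, (∏ j, linkWeight (r j (s j)) (z j)) *
        (if ∏ j, linkWeight (r j (s j)) (z j) ≤ ∏ j, linkWeight (r j (-s j)) (z j)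
          then 1 else 0) := by
  have h := two_pow_mul_prod_le_sum_min hK r hr
  set P : (A → ℤˣ) → (A → Bool) → ℝ := fun s z => ∏ j, linkWeight (r j (s j)) (z j) with hP
  have hP0 : ∀ s z, 0 ≤ P s z := fun s z =>
    Finset.prod_nonneg fun j _ => (linkWeight_mem (hr _ _) _).1
  -- The minimum of P(s) and P(-s) is charged to whichever is smaller. The substitution s ↦ -s shows
  -- that both charges have the same total, whence the factor 1/2.
  have e : ∑ s : A → ℤˣ, ∑ z : A → Bool, P s z * (if P s z ≤ P (-s) z then 1 else 0) =
      ∑ s : A → ℤˣ, ∑ z : A → Bool, P (-s) z * (if P (-s) z ≤ P s z then 1 else 0) := by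
    refine Fintype.sum_equiv (Equiv.neg _) _ _ fun s => ?_
    simp
  have key : ∑ s : A → ℤˣ, ∑ z : A → Bool, min (P s z) (P (-s) z) ≤
      ∑ s : A → ℤˣ, ∑ z : A → Bool, P s z * (if P s z ≤ P (-s) z then 1 else 0) +
      ∑ s : A → ℤˣ, ∑ z : A → Bool, P (-s) z * (if P (-s) z ≤ P s z then 1 else 0) := by
    simp_rw [← Finset.sum_add_distrib]
    refine Finset.sum_le_sum fun s _ => Finset.sum_le_sum fun z _ => ?_
    have := hP0 s z
    have := hP0 (-s) z
    rcases le_total (P s z) (P (-s) z) with h | h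
    · rw [min_eq_left h, if_pos h]
      split_ifs <;> linarith
    · rw [min_eq_right h, if_pos h]
      split_ifs <;> linarith
  rw [← e] at key
  change _ ≤ ∑ s : A → ℤˣ, ∑ z : A → Bool, P s z * (if P s z ≤ P (-s) z then 1 else 0)
  have h' : _ ≤ ∑ s : A → ℤˣ, ∑ z : A → Bool, min (P s z) (P (-s) z) := h
  linarith

end Block


/-! ### The same estimate with the label of the central node averaged as well -/

section OptionBlock

variable {A : Type*} [Fintype A]

/-- The indicator that flipping the distinguished label makes the link pattern less likely. -/
noncomputable def flipUnlikely (r : A → ℤˣ → ℝ) (s : Option A → ℤˣ) (z : A → Bool) : ℝ :=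
  if ∏ j, linkWeight (r j (s none * s (some j))) (z j) ≤
    ∏ j, linkWeight (r j (-(s none * s (some j)))) (z j) then 0 else 1

theorem flipUnlikely_nonneg (r : A → ℤˣ → ℝ) (s : Option A → ℤˣ) (z : A → Bool) :
    0 ≤ flipUnlikely r s z := by
  unfold flipUnlikely; split_ifs <;> norm_num

/-- Conditionally on the central label τ, the relative signs `τ * s j` are again uniform. Since the
affinity is symmetric, the bound for a block with free signs applies with the same value for both τ,
and passing to the complement gives the claim. -/
theorem sum_flipUnlikely_le [DecidableEq A] {K : ℝ} (hK : 0 < K) (r : A → ℤˣ → ℝ)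
    (hr : ∀ j τ, r j τ ∈ Set.Icc (0 : ℝ) 1) :
    ∑ s : Option A → ℤˣ, (∏ _j : Option A, (1 / 2 : ℝ)) *
        ∑ z : A → Bool, (∏ j, linkWeight (r j (s none * s (some j))) (z j)) *
          flipUnlikely r s z ≤
      1 - Real.exp (-K / 4) / 2 * ∏ j, max 0 (affinity (r j 1) (r j (-1)) - 8 / K) := by
  rw [← Finset.mul_sum, Finset.prod_const, Finset.card_univ, Fintype.card_option, pow_succ]
  rw [← (Equiv.piOptionEquivProd (β := fun _ : Option A => ℤˣ)).symm.sum_comp,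
    Fintype.sum_prod_type]
  have hτ : ∀ τ : ℤˣ, ∑ s : A → ℤˣ, ∑ z : A → Bool,
      (∏ j, linkWeight (r j (τ * s j)) (z j)) *
      flipUnlikely r ((Equiv.piOptionEquivProd (β := fun _ : Option A => ℤˣ)).symm (τ, s)) z ≤
      2 ^ Fintype.card A * (1 - Real.exp (-K / 4) / 2 *
      ∏ j, max 0 (affinity (r j 1) (r j (-1)) - 8 / K)) := by
    intro τ
    have hb := le_sum_flip_likely hK (fun j s => r j (τ * s)) fun j s => hr _ _
    have haff : ∀ j : A, affinity (r j (τ * 1)) (r j (τ * -1)) =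
        affinity (r j 1) (r j (-1)) := by
      intro j
      rcases Int.units_eq_one_or τ with rfl | rfl
      · simp
      · simpa using affinity_comm _ _
    simp_rw [haff] at hb
    have htot : ∀ s : A → ℤˣ, ∑ z : A → Bool,
        ∏ j, linkWeight (r j (τ * s j)) (z j) = 1 := by
      intro s
      rw [← Fintype.piFinset_univ, ← Finset.prod_univ_sum]
      exact Finset.prod_eq_one fun e _ => sum_linkWeight _
    have hcard : ∑ s : A → ℤˣ, ∑ z : A → Bool,
        ∏ j, linkWeight (r j (τ * s j)) (z j) = 2 ^ Fintype.card A := by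
      simp_rw [htot]
      simp
    have hsplit : ∑ s : A → ℤˣ, ∑ z : A → Bool, (∏ j, linkWeight (r j (τ * s j)) (z j)) *
        flipUnlikely r ((Equiv.piOptionEquivProd (β := fun _ : Option A => ℤˣ)).symm (τ, s)) z +
        ∑ s : A → ℤˣ, ∑ z : A → Bool, (∏ j, linkWeight (r j (τ * s j)) (z j)) *
      (if ∏ j, linkWeight (r j (τ * s j)) (z j) ≤ ∏ j, linkWeight (r j (τ * -s j)) (z j)
        then 1 else 0) = 2 ^ Fintype.card A := by
      rw [← hcard, ← Finset.sum_add_distrib]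
      refine Finset.sum_congr rfl fun s _ => ?_
      rw [← Finset.sum_add_distrib]
      refine Finset.sum_congr rfl fun z _ => ?_
      rw [← mul_add]
      simp only [flipUnlikely, Equiv.piOptionEquivProd_symm_apply, mul_neg]
      split_ifs <;> simp
    linarith
  have h2 : ∀ n : ℕ, (0 : ℝ) < (1 / 2) ^ n := fun n => by positivity
  have e : ∀ n : ℕ, ∀ x : ℝ, (1 / 2 : ℝ) ^ n * (1 / 2) * (2 ^ n * x + 2 ^ n * x) = x := by
    intro n x
    rw [one_div, inv_pow]; field_simp; ring
  refine (mul_le_mul_of_nonneg_left ?_ (by positivity)).trans (le_of_eq (e _ _))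
  rw [UnitsInt.univ, Finset.sum_insert (by decide), Finset.sum_singleton]
  exact add_le_add (hτ 1) (hτ (-1))

end OptionBlock

/-! ### Rival labellings for fixed locations -/

section FixedLocations

variable {N : ℕ}

open Classical in
/-- The indicator of the edges of `G`, read on increasing pairs. -/
noncomputable def edgeCode (G : SimpleGraph (Fin N)) (e : Fin N × Fin N) : Bool :=
  decide (e.1 < e.2 ∧ G.Adj e.1 e.2)

/-- The probability of the graph `G` given the labels, when `u` and `v` are linked with
probability `r u v (σ u * σ v)`. -/
noncomputable def graphWeight (r : Fin N → Fin N → ℤˣ → ℝ) (σ : Fin N → ℤˣ)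
    (G : SimpleGraph (Fin N)) : ℝ :=
  ∏ e : Fin N × Fin N with e.1 < e.2,
    linkWeight (r e.1 e.2 (σ e.1 * σ e.2)) (edgeCode G e)

/-- The weight of a link indicator at a pair; only increasing pairs carry links. -/
def pairWeight (r : Fin N → Fin N → ℤˣ → ℝ) (σ : Fin N → ℤˣ) (e : Fin N × Fin N) (z : Bool) : ℝ :=
  linkWeight (if e.1 < e.2 then r e.1 e.2 (σ e.1 * σ e.2) else 0) z

theorem edgeCode_injective : Function.Injective (edgeCode (N := N)) := by
  intro G G' h
  have key : ∀ u v : Fin N, u < v → (G.Adj u v ↔ G'.Adj u v) := by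
    intro u v huv
    have := congrFun h (u, v)
    simpa [edgeCode, huv] using this
  ext u v
  rcases lt_trichotomy u v with h | rfl | h
  · exact key _ _ h
  · simp
  · rw [G.adj_comm, G'.adj_comm, key _ _ h]

theorem mem_range_edgeCode {y : Fin N × Fin N → Bool} (hy : ∀ e, y e = true → e.1 < e.2) :
    y ∈ Set.range edgeCode := by
  refine ⟨SimpleGraph.fromRel fun u v => y (u, v) = true, ?_⟩
  ext ⟨u, v⟩
  unfold edgeCode
  rw [Bool.eq_iff_iff, @decide_eq_true_iff]
  constructor
  · rintro ⟨h, -, h1 | h1⟩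
    · exact h1
    · exact absurd (hy _ h1) (not_lt_of_gt h)
  · intro h
    have := hy _ h
    exact ⟨this, by simpa using this.ne, Or.inl h⟩

theorem prod_pairWeight_edgeCode (r : Fin N → Fin N → ℤˣ → ℝ) (σ : Fin N → ℤˣ)
    (G : SimpleGraph (Fin N)) : ∏ e, pairWeight r σ e (edgeCode G e) = graphWeight r σ G := by
  rw [graphWeight, Finset.prod_filter]
  refine Finset.prod_congr rfl fun e _ => ?_
  unfold pairWeight
  split_ifs with h
  · rfl
  · simp [edgeCode, h, linkWeight]

/-- Codes that are not graphs carry a link at a non-increasing pair, where the rate is 0, so they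
have weight zero. Summing over graphs thus becomes summing over a product space with independent
coordinates. -/
theorem sum_graphWeight_mul (r : Fin N → Fin N → ℤˣ → ℝ) (σ : Fin N → ℤˣ)
    (F : (Fin N × Fin N → Bool) → ℝ) :
    ∑ G, graphWeight r σ G * F (edgeCode G) = ∑ y, (∏ e, pairWeight r σ e (y e)) * F y := by
  refine Fintype.sum_of_injective edgeCode edgeCode_injective _ _ (fun y hy => ?_) fun G => ?_
  · have : ∃ e, y e = true ∧ ¬ e.1 < e.2 := by
      by_contra! h
      exact hy (mem_range_edgeCode h)
    obtain ⟨e, he, hlt⟩ := this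
    rw [Finset.prod_eq_zero (Finset.mem_univ e), zero_mul]
    simp [pairWeight, he, hlt, linkWeight]
  · rw [prod_pairWeight_edgeCode]

theorem sum_pairWeight (r : Fin N → Fin N → ℤˣ → ℝ) (σ : Fin N → ℤˣ) (e : Fin N × Fin N) :
    ∑ z, pairWeight r σ e z = 1 := sum_linkWeight _

theorem sum_graphWeight (r : Fin N → Fin N → ℤˣ → ℝ) (σ : Fin N → ℤˣ) :
    ∑ G, graphWeight r σ G = 1 := by
  have h := sum_graphWeight_mul r σ fun _ => 1
  simp only [mul_one] at h
  rw [h, ← Fintype.piFinset_univ, ← Finset.prod_univ_sum]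
  exact Finset.prod_eq_one fun e _ => sum_pairWeight r σ e

theorem graphWeight_nonneg {r : Fin N → Fin N → ℤˣ → ℝ}
    (hr : ∀ u v τ, r u v τ ∈ Set.Icc (0 : ℝ) 1) (σ : Fin N → ℤˣ) (G : SimpleGraph (Fin N)) :
    0 ≤ graphWeight r σ G :=
  Finset.prod_nonneg fun _ _ => (linkWeight_mem (hr _ _ _) _).1

/-- If a rival labelling at least as likely as the truth exists, an estimator that finds the truth
pays for it with the rival. -/
theorem sum_success_le {S Γ : Type*} [Fintype S] [DecidableEq S] [Fintype Γ] [Neg S]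
    (w : S → Γ → ℝ) (hw : ∀ σ G, 0 ≤ w σ G) (T : Γ → S) (hTT : ∀ σ : S, - -σ = σ)
    (B : S → Γ → Prop) [∀ σ G, Decidable (B σ G)]
    (hB : ∀ σ G, B σ G → ∃ σ', σ' ≠ σ ∧ σ' ≠ -σ ∧ w σ G ≤ w σ' G) :
    3 * ∑ σ, ∑ G, (if T G = σ ∨ T G = -σ then w σ G else 0) ≤
      2 * ∑ σ, ∑ G, w σ G + ∑ σ, ∑ G, if B σ G then 0 else w σ G := by
  rw [Finset.sum_comm, Finset.sum_comm (f := w), Finset.sum_comm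
    (f := fun (σ : S) (G : Γ) => if B σ G then 0 else w σ G), Finset.mul_sum, Finset.mul_sum,
    ← Finset.sum_add_distrib]
  refine Finset.sum_le_sum fun G _ => ?_
  set t := T G
  have hmem : ∀ σ, (t = σ ∨ t = -σ) ↔ σ ∈ ({t, -t} : Finset S) := by
    intro σ
    simp only [Finset.mem_insert, Finset.mem_singleton]
    constructor
    · rintro (h | h)
      · exact Or.inl h.symm
      · right; rw [h, hTT]
    · rintro (h | h)
      · exact Or.inl h.symm
      · right; rw [h, hTT]
  have e1 : ∑ σ, (if t = σ ∨ t = -σ then w σ G else 0) = ∑ σ ∈ {t, -t}, w σ G := by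
    simp_rw [hmem]
    rw [Finset.sum_ite_mem, Finset.univ_inter]
  have e2 : ∑ σ, w σ G = ∑ σ ∈ {t, -t}, w σ G + ∑ σ ∈ ({t, -t} : Finset S)ᶜ, w σ G :=
    (Finset.sum_add_sum_compl _ _).symm
  have e3 : ∑ σ ∈ {t, -t}, (if B σ G then 0 else w σ G) ≤ ∑ σ, if B σ G then 0 else w σ G :=
    Finset.sum_le_sum_of_subset_of_nonneg (Finset.subset_univ _) fun σ _ _ => by
      split_ifs <;> simp [hw]
  -- A rival of a member of {t, -t} lies outside that pair, so its weight is part of the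
  -- complementary mass; the pair has at most two members.
  have e4 : ∑ σ ∈ {t, -t}, (if B σ G then w σ G else 0) ≤
      2 * ∑ σ ∈ ({t, -t} : Finset S)ᶜ, w σ G := by
    have hR : 0 ≤ ∑ σ ∈ ({t, -t} : Finset S)ᶜ, w σ G := Finset.sum_nonneg fun _ _ => hw _ _
    have h : ∀ σ ∈ ({t, -t} : Finset S), (if B σ G then w σ G else 0) ≤
        ∑ σ ∈ ({t, -t} : Finset S)ᶜ, w σ G := by
      intro σ hσ
      split_ifs with hb
      · obtain ⟨σ', h1, h2, h3⟩ := hB σ G hb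
        refine h3.trans (Finset.single_le_sum (f := fun σ => w σ G) (fun _ _ => hw _ _) ?_)
        simp only [Finset.mem_compl, Finset.mem_insert, Finset.mem_singleton] at hσ ⊢
        rcases hσ with rfl | rfl
        · tauto
        · rw [hTT] at h2; tauto
      · exact hR
    refine (Finset.sum_le_card_nsmul _ _ _ h).trans ?_
    rw [nsmul_eq_mul]
    have : ((({t, -t} : Finset S).card : ℕ) : ℝ) ≤ 2 := by exact_mod_cast Finset.card_le_two
    exact mul_le_mul_of_nonneg_right this hR
  have e5 : ∑ σ ∈ {t, -t}, w σ G = ∑ σ ∈ {t, -t}, (if B σ G then w σ G else 0) +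
      ∑ σ ∈ {t, -t}, (if B σ G then 0 else w σ G) := by
    rw [← Finset.sum_add_distrib]
    exact Finset.sum_congr rfl fun σ _ => by split_ifs <;> simp
  rw [e1, e2]
  linarith

/-- The increasing pair with the given members. -/
def sortedPair (i j : Fin N) : Fin N × Fin N := (min i j, max i j)

theorem sortedPair_of_lt {i j : Fin N} (h : i < j) : sortedPair i j = (i, j) := by
  simp [sortedPair, h.le]

theorem sortedPair_comm (i j : Fin N) : sortedPair i j = sortedPair j i := by
  simp [sortedPair, min_comm, max_comm]

theorem sortedPair_eq {i j k l : Fin N} (h : sortedPair i j = sortedPair k l) :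
    (i = k ∧ j = l) ∨ (i = l ∧ j = k) := by
  simp only [sortedPair, Prod.mk.injEq] at h
  obtain ⟨h1, h2⟩ := h
  rcases le_total i j with h3 | h3 <;> rcases le_total k l with h4 | h4 <;>
    simp only [h3, h4, min_eq_left, min_eq_right, max_eq_left, max_eq_right] at h1 h2 <;> tauto

theorem pairWeight_sortedPair {r : Fin N → Fin N → ℤˣ → ℝ} (hsymm : ∀ u v, r u v = r v u)
    (σ : Fin N → ℤˣ) {i j : Fin N} (h : i ≠ j) (z : Bool) :
    pairWeight r σ (sortedPair i j) z = linkWeight (r i j (σ i * σ j)) z := by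
  rcases lt_or_gt_of_ne h with h | h
  · simp [sortedPair_of_lt h, pairWeight, h]
  · rw [sortedPair_comm, sortedPair_of_lt h]
    simp [pairWeight, h, hsymm i j, mul_comm]

/-- Flip the label of one node. -/
def flipLabel (σ : Fin N → ℤˣ) (i : Fin N) : Fin N → ℤˣ := Function.update σ i (-σ i)

theorem apply_neg_of_eq {f : ℤˣ → ℝ} (h : f 1 = f (-1)) (τ : ℤˣ) : f (-τ) = f τ := by
  rcases Int.units_eq_one_or τ with rfl | rfl <;> simp [h]

/-- Only the links between i and `A` feel the label of i: the pairs away from i do not change, and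
for the remaining neighbours both rates agree. The other factors cancel from the comparison. -/
theorem graphWeight_le_flipLabel {r : Fin N → Fin N → ℤˣ → ℝ} (hsymm : ∀ u v, r u v = r v u)
    (hr : ∀ u v τ, r u v τ ∈ Set.Icc (0 : ℝ) 1) {i : Fin N} {A : Finset (Fin N)} (hi : i ∉ A)
    (hout : ∀ j, j ≠ i → j ∉ A → r i j 1 = r i j (-1)) (σ : Fin N → ℤˣ)
    (G : SimpleGraph (Fin N))
    (h : ∏ j : A, linkWeight (r i j (σ i * σ j)) (edgeCode G (sortedPair i j)) ≤
      ∏ j : A, linkWeight (r i j (-(σ i * σ j))) (edgeCode G (sortedPair i j))) :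
    graphWeight r σ G ≤ graphWeight r (flipLabel σ i) G := by
  rw [← prod_pairWeight_edgeCode, ← prod_pairWeight_edgeCode]
  have hinj : Set.InjOn (sortedPair i) (A : Set (Fin N)) := by
    intro j hj k hk hjk
    rcases sortedPair_eq hjk with h | h
    · exact h.2
    · exact absurd (h.1 ▸ hk) hi
  have hne : ∀ j ∈ A, i ≠ j := fun j hj hij => hi (hij ▸ hj)
  have split : ∀ σ : Fin N → ℤˣ, ∏ e, pairWeight r σ e (edgeCode G e) =
      (∏ j : A, linkWeight (r i j (σ i * σ j)) (edgeCode G (sortedPair i j))) *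
        ∏ e ∈ (A.image (sortedPair i))ᶜ, pairWeight r σ e (edgeCode G e) := by
    intro σ
    rw [← Finset.prod_mul_prod_compl (A.image (sortedPair i)), Finset.prod_image hinj,
      ← Finset.prod_coe_sort A]
    congr 1
    exact Finset.prod_congr rfl fun j _ => pairWeight_sortedPair hsymm σ (hne j j.2) _
  have rest : ∏ e ∈ (A.image (sortedPair i))ᶜ, pairWeight r (flipLabel σ i) e (edgeCode G e) =
      ∏ e ∈ (A.image (sortedPair i))ᶜ, pairWeight r σ e (edgeCode G e) := by
    refine Finset.prod_congr rfl fun e he => ?_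
    obtain ⟨u, v⟩ := e
    unfold pairWeight
    by_cases huv : u < v
    · simp only [huv, if_true]
      congr 1
      have hA : ∀ j ∈ A, sortedPair i j ≠ (u, v) := by
        intro j hj hj'
        simp only [Finset.mem_compl, Finset.mem_image, not_exists, not_and] at he
        exact he j hj hj'
      by_cases hu : u = i
      · subst hu
        have hv : v ∉ A := fun hv => hA v hv (sortedPair_of_lt huv)
        have := apply_neg_of_eq (hout v huv.ne' hv) (σ u * σ v)
        simpa [flipLabel, huv.ne'] using this
      · by_cases hv : v = i
        · subst hv
          have hu' : u ∉ A := fun hu => hA u hu (by rw [sortedPair_comm, sortedPair_of_lt huv])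
          have := apply_neg_of_eq (hout u huv.ne hu') (σ u * σ v)
          simpa [flipLabel, huv.ne, hsymm u v] using this
        · simp [flipLabel, hu, hv]
    · simp [huv]
  rw [split, split, rest]
  refine mul_le_mul_of_nonneg_right ?_ (Finset.prod_nonneg fun e _ => ?_)
  · refine h.trans (le_of_eq (Finset.prod_congr rfl fun j _ => ?_))
    have : (j : Fin N) ≠ i := (hne j j.2).symm
    simp [flipLabel, this]
  · unfold pairWeight
    refine (linkWeight_mem ?_ _).1
    split_ifs
    · exact hr _ _ _
    · simp

/-- The probability that no node of `C` can be flipped without loss of likelihood. -/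
theorem sum_no_flip_le {r : Fin N → Fin N → ℤˣ → ℝ} (hsymm : ∀ u v, r u v = r v u)
    (hr : ∀ u v τ, r u v τ ∈ Set.Icc (0 : ℝ) 1) (C : Finset (Fin N)) (A : Fin N → Finset (Fin N))
    (hself : ∀ i ∈ C, i ∉ A i) (hC : ∀ i ∈ C, ∀ i' ∈ C, i ∉ A i')
    (hdisj : ∀ i ∈ C, ∀ i' ∈ C, i ≠ i' → Disjoint (A i) (A i'))
    (hout : ∀ i ∈ C, ∀ j, j ≠ i → j ∉ A i → r i j 1 = r i j (-1)) {K : ℝ} (hK : 0 < K) :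
    ∑ σ : Fin N → ℤˣ, ∑ G, (if ∃ i ∈ C, graphWeight r σ G ≤ graphWeight r (flipLabel σ i) G then 0
        else graphWeight r σ G) ≤
      2 ^ N * ∏ i ∈ C, (1 - Real.exp (-K / 4) / 2 *
        ∏ j ∈ A i, max 0 (affinity (r i j 1) (r i j (-1)) - 8 / K)) := by
  -- The links from the nodes of C to their neighbours, and the nodes involved (`none` stands for
  -- the centre). Both families are free of repetitions because the neighbourhoods are disjoint and
  -- avoid C; this is the source of independence.
  let mE : (Σ i : C, A i) → Fin N × Fin N := fun p => sortedPair p.1 p.2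
  let mV : (Σ i : C, Option (A i)) → Fin N := fun p => p.2.elim p.1 fun j => j
  have hmE : Function.Injective mE := by
    rintro ⟨⟨i, hi⟩, ⟨j, hj⟩⟩ ⟨⟨k, hk⟩, ⟨l, hl⟩⟩ h
    rcases sortedPair_eq h with ⟨h1, h2⟩ | ⟨h1, h2⟩
    · obtain rfl : i = k := h1
      obtain rfl : j = l := h2
      rfl
    · obtain rfl : i = l := h1
      exact absurd hl (hC _ hi _ hk)
  have hmV : Function.Injective mV := by
    rintro ⟨⟨i, hi⟩, j⟩ ⟨⟨k, hk⟩, l⟩ h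
    rcases j with _ | ⟨j, hj⟩ <;> rcases l with _ | ⟨l, hl⟩
    · obtain rfl : i = k := h
      rfl
    · obtain rfl : i = l := h
      exact absurd hl (hC _ hi _ hk)
    · obtain rfl : j = k := h
      exact absurd hj (hC _ hk _ hi)
    · obtain rfl : j = l := h
      obtain rfl : i = k := by
        by_contra hik
        exact (Finset.disjoint_left.1 (hdisj _ hi _ hk hik)) hj hl
      rfl
  have hneA : ∀ i : C, ∀ j : A i, (i : Fin N) ≠ j := fun i j h => hself i i.2
    (Eq.subst (motive := fun x => x ∈ A i) h.symm j.2)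
  -- Given the labels, the events at different centres depend on disjoint sets of links.
  have step1 : ∀ σ : Fin N → ℤˣ, ∑ G, (if ∃ i ∈ C, graphWeight r σ G ≤
      graphWeight r (flipLabel σ i) G then 0 else graphWeight r σ G) ≤
      ∏ i : C, ∑ z : A i → Bool, (∏ j : A i, linkWeight (r i j (σ i * σ j)) (z j)) *
        flipUnlikely (fun j : A i => r i j) (fun j => σ (mV ⟨i, j⟩)) z := by
    intro σ
    have h := sum_pi_prod_blocks (pairWeight r σ) (sum_pairWeight r σ) mE hmE
      (fun (i : C) z => flipUnlikely (fun j : A i => r i j) (fun j => σ (mV ⟨i, j⟩)) z)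
    have e : ∀ i : C, ∑ z : A i → Bool, (∏ j, pairWeight r σ (mE ⟨i, j⟩) (z j)) *
        flipUnlikely (fun j : A i => r i j) (fun j => σ (mV ⟨i, j⟩)) z = ∑ z : A i → Bool,
        (∏ j : A i, linkWeight (r i j (σ i * σ j)) (z j)) *
          flipUnlikely (fun j : A i => r i j) (fun j => σ (mV ⟨i, j⟩)) z := by
      intro i
      refine Finset.sum_congr rfl fun z _ => ?_
      congr 1
      exact Finset.prod_congr rfl fun j _ => pairWeight_sortedPair hsymm σ (hneA i j) _
    simp_rw [e] at h
    rw [← h, ← sum_graphWeight_mul r σ fun y => ∏ i : C,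
      flipUnlikely (fun j : A i => r i j) (fun j => σ (mV ⟨i, j⟩))
      (fun j => y (mE ⟨i, j⟩))]
    refine Finset.sum_le_sum fun G _ => ?_
    have hw := graphWeight_nonneg hr σ G
    split_ifs with hex
    · exact mul_nonneg hw (Finset.prod_nonneg fun i _ => flipUnlikely_nonneg _ _ _)
    · rw [Finset.prod_eq_one, mul_one]
      intro i _
      unfold flipUnlikely
      rw [if_neg]
      intro hle
      exact hex ⟨i, i.2, graphWeight_le_flipLabel hsymm hr (hself i i.2) (hout i i.2) σ G hle⟩
  -- The labels in different blocks are disjoint coordinates of a uniform labelling, so the average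
  -- over σ factorises too.
  have step2 : ∑ σ : Fin N → ℤˣ, ∏ i : C, ∑ z : A i → Bool,
      (∏ j : A i, linkWeight (r i j (σ i * σ j)) (z j)) *
          flipUnlikely (fun j : A i => r i j) (fun j => σ (mV ⟨i, j⟩)) z =
      2 ^ N * ∏ i : C, ∑ s : Option (A i) → ℤˣ, (∏ _j : Option (A i), (1 / 2 : ℝ)) *
        ∑ z : A i → Bool, (∏ j : A i, linkWeight (r i j (s none * s (some j))) (z j)) *
          flipUnlikely (fun j : A i => r i j) s z := by
    rw [← sum_pi_prod_blocks (ι := Fin N) (fun _ (_ : ℤˣ) => (1 / 2 : ℝ)) (by simp) mV hmV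
      (fun (i : C) s => ∑ z : A i → Bool,
        (∏ j : A i, linkWeight (r i j (s none * s (some j))) (z j)) *
        flipUnlikely (fun j : A i => r i j) s z), Finset.mul_sum]
    refine Finset.sum_congr rfl fun σ _ => ?_
    rw [Finset.prod_const, Finset.card_univ, Fintype.card_fin, ← mul_assoc, ← mul_pow]
    norm_num
    rfl
  refine (Finset.sum_le_sum fun σ _ => step1 σ).trans ?_
  rw [step2, ← Finset.prod_coe_sort C]
  refine mul_le_mul_of_nonneg_left (Finset.prod_le_prod (fun i _ => ?_) fun i _ => ?_)
    (by positivity)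
  · refine Finset.sum_nonneg fun s _ => mul_nonneg (by positivity) (Finset.sum_nonneg fun z _ =>
    mul_nonneg (Finset.prod_nonneg fun j _ => (linkWeight_mem (hr _ _ _) _).1)
      (flipUnlikely_nonneg _ _ _))
  · refine (sum_flipUnlikely_le hK (fun j : A i => r i j) fun j τ => hr _ _ _).trans (le_of_eq ?_)
    rw [Finset.prod_coe_sort (A i) fun j => max 0 (affinity (r i j 1) (r i j (-1)) - 8 / K)]

end FixedLocations


/-! ### First and second moments of the isolation sum -/

section IsolationCount

variable {Ω : Type*} [MeasurableSpace Ω] (μ : Measure Ω) [IsProbabilityMeasure μ]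

theorem integrable_of_mem_Icc {Ω : Type*} [MeasurableSpace Ω] {μ : Measure Ω} [IsFiniteMeasure μ]
    {f : Ω → ℝ} (hf : Measurable f) {c : ℝ} (h : ∀ x, f x ∈ Set.Icc 0 c) : Integrable f μ :=
  Integrable.of_bound hf.aestronglyMeasurable c
    (ae_of_all _ fun x => by rw [Real.norm_of_nonneg (h x).1]; exact (h x).2)

theorem integral_pi_eq_insertNth {M : ℕ} (i : Fin (M + 1)) {f : (Fin (M + 1) → Ω) → ℝ}
    (hf : Measurable f) (h : ∀ X, f X ∈ Set.Icc (0 : ℝ) 1) :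
    ∫ X, f X ∂(Measure.pi fun _ => μ) =
      ∫ x, ∫ Y, f (i.insertNth x Y) ∂(Measure.pi fun _ => μ) ∂μ := by
  have hmp := (measurePreserving_piFinSuccAbove (fun _ : Fin (M + 1) => μ) i).symm
  rw [← hmp.integral_comp']
  rw [integral_prod]
  · rfl
  · exact integrable_of_mem_Icc (hf.comp (MeasurableEquiv.measurable _)) fun x => h _

/-- The number of points of `X` in `C`, each weighted by how isolated it is from the others. -/
noncomputable def isolationWeight {Ω : Type*} (C : Set Ω) (g : Ω → Ω → ℝ) {N : ℕ} (X : Fin N → Ω)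
    (i : Fin N) : ℝ :=
  C.indicator 1 (X i) * ∏ j ∈ {i}ᶜ, g (X i) (X j)

/-- The sum of the isolation weights. -/
noncomputable def isolationSum {Ω : Type*} (C : Set Ω) (g : Ω → Ω → ℝ) {N : ℕ}
    (X : Fin N → Ω) : ℝ :=
  ∑ i, isolationWeight C g X i

variable {C : Set Ω} {g : Ω → Ω → ℝ}

theorem prod_compl_singleton {M : ℕ} (i : Fin (M + 1)) (f : Fin (M + 1) → ℝ) :
    ∏ j ∈ {i}ᶜ, f j = ∏ k, f (i.succAbove k) := by
  rw [← Fin.image_succAbove_univ, Finset.prod_image fun _ _ _ _ h =>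
    Fin.succAbove_right_injective h]

theorem indicator_one_mem {Ω : Type*} (C : Set Ω) (x : Ω) :
    C.indicator (1 : Ω → ℝ) x ∈ Set.Icc (0 : ℝ) 1 := by
  by_cases h : x ∈ C <;> simp [h]

theorem prod_mem_Icc {ι : Type*} (s : Finset ι) {f : ι → ℝ} (h : ∀ i, f i ∈ Set.Icc (0 : ℝ) 1) :
    ∏ i ∈ s, f i ∈ Set.Icc (0 : ℝ) 1 :=
  ⟨Finset.prod_nonneg fun i _ => (h i).1,
    Finset.prod_le_one (fun i _ => (h i).1) fun i _ => (h i).2⟩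

theorem mul_mem_Icc {a b : ℝ} (ha : a ∈ Set.Icc (0 : ℝ) 1) (hb : b ∈ Set.Icc (0 : ℝ) 1) :
    a * b ∈ Set.Icc (0 : ℝ) 1 :=
  ⟨mul_nonneg ha.1 hb.1, mul_le_one₀ ha.2 hb.1 hb.2⟩

theorem isolationWeight_mem {Ω : Type*} {C : Set Ω} {g : Ω → Ω → ℝ}
    (hg : ∀ x y, g x y ∈ Set.Icc (0 : ℝ) 1) {N : ℕ} (X : Fin N → Ω)
    (i : Fin N) : isolationWeight C g X i ∈ Set.Icc (0 : ℝ) 1 :=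
  mul_mem_Icc (indicator_one_mem _ _) (prod_mem_Icc _ fun _ => hg _ _)

theorem measurable_isolationWeight (hC : MeasurableSet C) (hgm : Measurable (Function.uncurry g))
    {N : ℕ} (i : Fin N) : Measurable fun X : Fin N → Ω => isolationWeight C g X i := by
  unfold isolationWeight
  refine ((measurable_one.indicator hC).comp (measurable_pi_apply i)).mul ?_
  refine Finset.measurable_fun_prod _ fun j _ => ?_
  exact hgm.comp (f := fun X : Fin N → Ω => (X i, X j))
    ((measurable_pi_apply i).prodMk (measurable_pi_apply j))

theorem measurable_isolationSum (hC : MeasurableSet C) (hgm : Measurable (Function.uncurry g))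
    {N : ℕ} : Measurable fun X : Fin N → Ω => isolationSum C g X :=
  Finset.measurable_fun_sum _ fun i _ => measurable_isolationWeight hC hgm i

theorem isolationSum_mem {Ω : Type*} {C : Set Ω} {g : Ω → Ω → ℝ}
    (hg : ∀ x y, g x y ∈ Set.Icc (0 : ℝ) 1) {N : ℕ} (X : Fin N → Ω) :
    isolationSum C g X ∈ Set.Icc (0 : ℝ) N := by
  refine ⟨Finset.sum_nonneg fun i _ => (isolationWeight_mem hg X i).1, ?_⟩
  refine (Finset.sum_le_sum fun i _ => (isolationWeight_mem hg X i).2).trans ?_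
  simp

theorem integral_section (hgm : Measurable (Function.uncurry g))
    (hg : ∀ x y, g x y ∈ Set.Icc (0 : ℝ) 1) {α : ℝ} (hα : ∀ x, ∫ y, (1 - g x y) ∂μ = α) (x : Ω) :
    ∫ y, g x y ∂μ = 1 - α := by
  have hi : Integrable (g x) μ := integrable_of_mem_Icc hgm.of_uncurry_left (hg x)
  have := hα x
  rw [integral_sub (integrable_const _) hi] at this
  simp at this
  linarith

theorem integral_isolationWeight (hC : MeasurableSet C) (hgm : Measurable (Function.uncurry g))
    (hg : ∀ x y, g x y ∈ Set.Icc (0 : ℝ) 1) {α : ℝ} (hα : ∀ x, ∫ y, (1 - g x y) ∂μ = α) {M : ℕ}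
    (i : Fin (M + 1)) :
    ∫ X, isolationWeight C g X i ∂(Measure.pi fun _ => μ) = μ.real C * (1 - α) ^ M := by
  rw [integral_pi_eq_insertNth μ i (measurable_isolationWeight hC hgm i)
    fun X => isolationWeight_mem hg X i]
  have h : ∀ x, ∫ Y, isolationWeight C g (i.insertNth x Y : Fin (M + 1) → Ω) i
      ∂(Measure.pi fun _ => μ) = C.indicator 1 x * (1 - α) ^ M := by
    intro x
    simp only [isolationWeight, prod_compl_singleton, Fin.insertNth_apply_same,
      Fin.insertNth_apply_succAbove]
    rw [integral_const_mul, integral_fintype_prod_eq_prod (fun _ : Fin M => g x)]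
    simp [integral_section μ hgm hg hα]
  simp_rw [h]
  rw [integral_mul_const, integral_indicator_one hC]

/-- Integrate out all but two points. If both weights can be nonzero, `hsep` says that 1 - g(x, ·)
and 1 - g(y, ·) have disjoint supports, so a third point contributes 1 - 2α ≤ (1 - α)². Distinct
isolated points are thus at most about as correlated as independent ones. -/
theorem integral_isolationWeight_mul_le (hC : MeasurableSet C)
    (hgm : Measurable (Function.uncurry g)) (hg : ∀ x y, g x y ∈ Set.Icc (0 : ℝ) 1) {α : ℝ}
    (hα : ∀ x, ∫ y, (1 - g x y) ∂μ = α)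
    (hsep : ∀ x ∈ C, ∀ y ∈ C, g x y ≠ 0 → g y x ≠ 0 → ∀ z, (1 - g x z) * (1 - g y z) = 0) {L : ℕ}
    (i : Fin (L + 2)) (k : Fin (L + 1)) :
    ∫ X, isolationWeight C g X i * isolationWeight C g X (i.succAbove k)
      ∂(Measure.pi fun _ => μ) ≤ μ.real C ^ 2 * ((1 - α) ^ 2) ^ L := by
  have hmeas : Measurable fun X : Fin (L + 2) → Ω =>
      isolationWeight C g X i * isolationWeight C g X (i.succAbove k) :=
    (measurable_isolationWeight hC hgm i).mul (measurable_isolationWeight hC hgm _)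
  have hmem : ∀ X : Fin (L + 2) → Ω,
      isolationWeight C g X i * isolationWeight C g X (i.succAbove k) ∈ Set.Icc (0 : ℝ) 1 :=
    fun X => mul_mem_Icc (isolationWeight_mem hg X _) (isolationWeight_mem hg X _)
  rw [integral_pi_eq_insertNth μ i hmeas hmem]
  have hgx : ∀ x, Measurable (g x) := fun x => hgm.of_uncurry_left
  have hbound : ∀ x y, ∫ Z : Fin L → Ω, isolationWeight C g
        (i.insertNth x (k.insertNth y Z : Fin (L + 1) → Ω) : Fin (L + 2) → Ω) i *
      isolationWeight C g (i.insertNth x (k.insertNth y Z : Fin (L + 1) → Ω) : Fin (L + 2) → Ω)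
        (i.succAbove k) ∂(Measure.pi fun _ => μ) ≤
      C.indicator 1 x * (C.indicator 1 y * ((1 - α) ^ 2) ^ L) := by
    intro x y
    have e : ∀ Z : Fin L → Ω, isolationWeight C g
          (i.insertNth x (k.insertNth y Z : Fin (L + 1) → Ω) : Fin (L + 2) → Ω) i *
        isolationWeight C g (i.insertNth x (k.insertNth y Z : Fin (L + 1) → Ω) : Fin (L + 2) → Ω)
          (i.succAbove k) =
        (C.indicator 1 x * C.indicator 1 y * (g x y * g y x)) * ∏ l, (g x (Z l) * g y (Z l)) := by
      intro Z
      -- The other points seen from the second node are the first node and the L remaining ones.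
      have h2 : ∏ j ∈ {i.succAbove k}ᶜ,
          g y ((i.insertNth x (k.insertNth y Z : Fin (L + 1) → Ω) : Fin (L + 2) → Ω) j) =
          g y x * ∏ l, g y (Z l) := by
        have h3 := Fin.prod_univ_succAbove (fun j => g y
          ((i.insertNth x (k.insertNth y Z : Fin (L + 1) → Ω) : Fin (L + 2) → Ω) j)) i
        have e3 : ({i.succAbove k}ᶜ : Finset (Fin (L + 2))) =
            insert i (Finset.univ.image fun l => i.succAbove (k.succAbove l)) := by
          ext j
          simp only [Finset.mem_compl, Finset.mem_singleton, Finset.mem_insert, Finset.mem_image,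
            Finset.mem_univ, true_and]
          constructor
          · intro hj
            by_cases hji : j = i
            · exact Or.inl hji
            · obtain ⟨l, rfl⟩ := Fin.exists_succAbove_eq hji
              have hlk : l ≠ k := fun h => hj (by rw [h])
              obtain ⟨m, rfl⟩ := Fin.exists_succAbove_eq hlk
              exact Or.inr ⟨m, rfl⟩
          · rintro (rfl | ⟨l, rfl⟩)
            · exact (Fin.succAbove_ne _ _).symm
            · exact fun h => Fin.succAbove_ne _ _ (Fin.succAbove_right_injective h)
        rw [e3, Finset.prod_insert, Finset.prod_image]
        · simp
        · intro a _ b _ h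
          exact Fin.succAbove_right_injective (Fin.succAbove_right_injective h)
        · simp only [Finset.mem_image, Finset.mem_univ, true_and, not_exists]
          exact fun l => Fin.succAbove_ne _ _
      unfold isolationWeight
      rw [prod_compl_singleton, Fin.prod_univ_succAbove _ k]
      simp only [Fin.insertNth_apply_same, Fin.insertNth_apply_succAbove]
      rw [h2, Finset.prod_mul_distrib]
      ring
    simp_rw [e]
    rw [integral_const_mul, integral_fintype_prod_eq_prod (fun (_ : Fin L) z => g x z * g y z),
      Finset.prod_const, Finset.card_univ, Fintype.card_fin]
    have hr : 0 ≤ ((1 - α) ^ 2) ^ L := by positivity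
    by_cases hx : x ∈ C
    · by_cases hy : y ∈ C
      · simp only [hx, hy, Set.indicator_of_mem, Pi.one_apply, one_mul]
        by_cases hxy : g x y = 0
        · simpa [hxy] using hr
        · by_cases hyx : g y x = 0
          · simpa [hyx] using hr
          · have hs := hsep x hx y hy hxy hyx
            have hint : ∫ z, g x z * g y z ∂μ = 1 - 2 * α := by
              have : ∀ z, g x z * g y z = g x z + g y z - 1 := fun z => by linarith [hs z]
              simp_rw [this]
              have i1 : Integrable (g x) μ := integrable_of_mem_Icc (hgx x) (hg x)
              have i2 : Integrable (g y) μ := integrable_of_mem_Icc (hgx y) (hg y)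
              rw [integral_sub (f := fun z => g x z + g y z) (i1.add i2) (integrable_const _),
                integral_add i1 i2,
                integral_section μ hgm hg hα, integral_section μ hgm hg hα]
              simp; ring
            -- Needed to take powers; it holds because 1 - 2α is the integral of a nonnegative
            -- function.
            have h0 : 0 ≤ 1 - 2 * α := hint ▸ integral_nonneg fun z =>
              mul_nonneg (hg x z).1 (hg y z).1
            rw [hint]
            have h1 : (1 - 2 * α) ^ L ≤ ((1 - α) ^ 2) ^ L :=
              pow_le_pow_left₀ h0 (by nlinarith [sq_nonneg α]) L
            have h2 := mul_mem_Icc (hg x y) (hg y x)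
            calc g x y * g y x * (1 - 2 * α) ^ L ≤ 1 * (1 - 2 * α) ^ L :=
                  mul_le_mul_of_nonneg_right h2.2 (pow_nonneg h0 _)
              _ ≤ _ := by rw [one_mul]; exact h1
      · simp [hy]
    · simp [hx]
  have hmemY : ∀ x, ∫ Y, isolationWeight C g (i.insertNth x Y : Fin (L + 2) → Ω) i *
      isolationWeight C g (i.insertNth x Y : Fin (L + 2) → Ω) (i.succAbove k)
        ∂(Measure.pi fun _ => μ) ≤ C.indicator 1 x * (μ.real C * ((1 - α) ^ 2) ^ L) := by
    intro x
    have hins : Measurable fun Y : Fin (L + 1) → Ω => (i.insertNth x Y : Fin (L + 2) → Ω) := by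
      have := (MeasurableEquiv.piFinSuccAbove (fun _ : Fin (L + 2) => Ω) i).symm.measurable
      exact this.comp (measurable_const.prodMk measurable_id)
    rw [integral_pi_eq_insertNth μ k (f := fun Y => isolationWeight C g
      (i.insertNth x Y : Fin (L + 2) → Ω) i * isolationWeight C g
      (i.insertNth x Y : Fin (L + 2) → Ω) (i.succAbove k)) (hmeas.comp hins) fun Y => hmem _]
    calc _ ≤ ∫ y, C.indicator 1 x * (C.indicator 1 y * ((1 - α) ^ 2) ^ L) ∂μ := by
          refine integral_mono_of_nonneg (ae_of_all _ fun y => integral_nonneg fun Z => (hmem _).1)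
            ?_ (ae_of_all _ fun y => hbound x y)
          refine ((Integrable.mul_const ?_ _).const_mul _)
          exact (integrable_indicator_iff hC).2 (integrable_const _).integrableOn
      _ = _ := by rw [integral_const_mul, integral_mul_const, integral_indicator_one hC]
  calc _ ≤ ∫ x, C.indicator 1 x * (μ.real C * ((1 - α) ^ 2) ^ L) ∂μ := by
        refine integral_mono_of_nonneg (ae_of_all _ fun y => integral_nonneg fun Z => (hmem _).1)
          ?_ (ae_of_all _ hmemY)
        refine Integrable.mul_const ?_ _
        exact (integrable_indicator_iff hC).2 (integrable_const _).integrableOn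
    _ = _ := by rw [integral_mul_const, integral_indicator_one hC]; ring

theorem integral_isolationSum (hC : MeasurableSet C) (hgm : Measurable (Function.uncurry g))
    (hg : ∀ x y, g x y ∈ Set.Icc (0 : ℝ) 1) {α : ℝ} (hα : ∀ x, ∫ y, (1 - g x y) ∂μ = α) {M : ℕ} :
    ∫ X : Fin (M + 1) → Ω, isolationSum C g X ∂(Measure.pi fun _ => μ) =
      (M + 1) * (μ.real C * (1 - α) ^ M) := by
  unfold isolationSum
  rw [integral_finsetSum _ fun i _ => integrable_of_mem_Icc (measurable_isolationWeight hC hgm i)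
    fun X => isolationWeight_mem hg X i]
  simp_rw [integral_isolationWeight μ hC hgm hg hα]
  simp

theorem integral_isolationSum_sq_le (hC : MeasurableSet C) (hgm : Measurable (Function.uncurry g))
    (hg : ∀ x y, g x y ∈ Set.Icc (0 : ℝ) 1) {α : ℝ} (hα : ∀ x, ∫ y, (1 - g x y) ∂μ = α)
    (hsep : ∀ x ∈ C, ∀ y ∈ C, g x y ≠ 0 → g y x ≠ 0 → ∀ z, (1 - g x z) * (1 - g y z) = 0)
    {L : ℕ} :
    ∫ X : Fin (L + 2) → Ω, isolationSum C g X ^ 2 ∂(Measure.pi fun _ => μ) ≤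
      (L + 2) * (μ.real C * (1 - α) ^ (L + 1)) +
        (L + 2) ^ 2 * (μ.real C ^ 2 * ((1 - α) ^ 2) ^ L) := by
  have hw := fun i => measurable_isolationWeight (N := L + 2) hC hgm i
  have hm := fun X i => isolationWeight_mem (C := C) (N := L + 2) hg X i
  have e : ∀ X : Fin (L + 2) → Ω, isolationSum C g X ^ 2 =
      ∑ i, (isolationWeight C g X i * isolationWeight C g X i +
        ∑ k, isolationWeight C g X i * isolationWeight C g X (i.succAbove k)) := by
    intro X
    rw [isolationSum, sq, Finset.sum_mul]
    refine Finset.sum_congr rfl fun i _ => ?_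
    rw [Finset.mul_sum, Fin.sum_univ_succAbove _ i]
  have hint : ∀ i j, Integrable (fun X : Fin (L + 2) → Ω =>
      isolationWeight C g X i * isolationWeight C g X j) (Measure.pi fun _ => μ) := fun i j =>
    integrable_of_mem_Icc ((hw i).mul (hw j)) fun X => mul_mem_Icc (hm X i) (hm X j)
  simp_rw [e]
  have hint' : ∀ i : Fin (L + 2), Integrable (fun X : Fin (L + 2) → Ω =>
      ∑ k, isolationWeight C g X i * isolationWeight C g X (i.succAbove k))
      (Measure.pi fun _ => μ) := fun i => integrable_finsetSum _ fun k _ => hint i _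
  rw [integral_finsetSum (f := fun (i : Fin (L + 2)) (X : Fin (L + 2) → Ω) =>
      isolationWeight C g X i * isolationWeight C g X i +
        ∑ k, isolationWeight C g X i * isolationWeight C g X (i.succAbove k)) _
    fun i _ => (hint i i).add (hint' i)]
  have hα' : 0 ≤ μ.real C ^ 2 * ((1 - α) ^ 2) ^ L := by positivity
  -- On the diagonal a weight in [0, 1] dominates its square; off the diagonal each node has L + 1
  -- partners.
  calc _ ≤ ∑ _i : Fin (L + 2), (μ.real C * (1 - α) ^ (L + 1) +
        (L + 1) * (μ.real C ^ 2 * ((1 - α) ^ 2) ^ L)) := by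
        refine Finset.sum_le_sum fun i _ => ?_
        rw [integral_add (hint i i) (hint' i),
          integral_finsetSum _ fun k _ => hint i _]
        refine add_le_add ?_ ?_
        · rw [← integral_isolationWeight μ hC hgm hg hα i]
          refine integral_mono (hint i i) (integrable_of_mem_Icc (hw i) fun X => hm X i) fun X => ?_
          exact mul_le_of_le_one_left (hm X i).1 (hm X i).2
        · refine (Finset.sum_le_sum fun k _ =>
            integral_isolationWeight_mul_le μ hC hgm hg hα hsep i k).trans ?_
          simp
    _ = (L + 2) * (μ.real C * (1 - α) ^ (L + 1)) +
        (L + 2) * (L + 1) * (μ.real C ^ 2 * ((1 - α) ^ 2) ^ L) := by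
        rw [Finset.sum_const, Finset.card_univ, Fintype.card_fin, nsmul_eq_mul]
        push_cast; ring
    _ ≤ _ := by
        have h1 : ((L : ℝ) + 2) * (L + 1) ≤ (L + 2) ^ 2 := by
          have : (0 : ℝ) ≤ L := Nat.cast_nonneg L
          nlinarith
        have := mul_le_mul_of_nonneg_right h1 hα'
        linarith

end IsolationCount


/-! ### From rivals to the success probability given the number of nodes -/

section CondLaw

instance : MeasurableSingletonClass ℤˣ where
  measurableSet_singleton x := by
    have : ({x} : Set ℤˣ) = Units.val ⁻¹' {(x : ℤ)} := by
      ext y; simp [Units.ext_iff]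
    rw [this]
    exact comap_measurable _ (measurableSet_singleton _)

instance {N : ℕ} : MeasurableSingletonClass (SimpleGraph (Fin N)) where
  measurableSet_singleton G := by
    have : ({G} : Set (SimpleGraph (Fin N))) = SimpleGraph.Adj ⁻¹' {G.Adj} := by
      ext G'; exact SimpleGraph.adj_inj.symm
    rw [this]
    exact SimpleGraph.measurable_adj (measurableSet_singleton _)

instance : IsProbabilityMeasure (volume : Measure Torus) := ⟨UnitAddCircle.measure_univ⟩

/-- The link probability as a function of the product of the two labels. -/
noncomputable def linkRate (p q : ℝ) (φ : ℝ≥0 → ℝ) (n : ℕ) {N : ℕ} (X : Fin N → Torus)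
    (u v : Fin N) (τ : ℤˣ) : ℝ :=
  (if τ = 1 then p else q) * psi φ n (X u) (X v)

variable {p q : ℝ} {φ : ℝ≥0 → ℝ}

theorem psi_mem (hφ : ∀ x, φ x ∈ Set.Icc (0 : ℝ) 1) (n : ℕ) (x y : Torus) :
    psi φ n x y ∈ Set.Icc (0 : ℝ) 1 := hφ _

theorem psi_comm (φ : ℝ≥0 → ℝ) (n : ℕ) (x y : Torus) : psi φ n x y = psi φ n y x := by
  simp [psi, dist_comm]

theorem linkRate_comm (p q : ℝ) (φ : ℝ≥0 → ℝ) (n : ℕ) {N : ℕ} (X : Fin N → Torus) (u v : Fin N) :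
    linkRate p q φ n X u v = linkRate p q φ n X v u := by
  ext τ; simp [linkRate, psi_comm φ n (X u)]

theorem linkRate_mem (hp : p ∈ Set.Icc (0 : ℝ) 1) (hq : q ∈ Set.Icc (0 : ℝ) 1)
    (hφ : ∀ x, φ x ∈ Set.Icc (0 : ℝ) 1) (n : ℕ) {N : ℕ} (X : Fin N → Torus) (u v : Fin N)
    (τ : ℤˣ) : linkRate p q φ n X u v τ ∈ Set.Icc (0 : ℝ) 1 := by
  unfold linkRate
  refine mul_mem_Icc ?_ (psi_mem hφ _ _ _)
  split_ifs
  · exact hp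
  · exact hq

theorem linkRate_mul_labels (p q : ℝ) (φ : ℝ≥0 → ℝ) (n : ℕ) {N : ℕ} (σ : Fin N → ℤˣ)
    (X : Fin N → Torus) (u v : Fin N) :
    linkRate p q φ n X u v (σ u * σ v) = linkProb p q φ n σ X u v := by
  have : σ u * σ v = 1 ↔ σ u = σ v := by
    rcases Int.units_eq_one_or (σ u) with h | h <;>
      rcases Int.units_eq_one_or (σ v) with h' | h' <;>
      simp [h, h']
  simp [linkRate, linkProb, this]

theorem graphProb_eq_ofReal (hp : p ∈ Set.Icc (0 : ℝ) 1) (hq : q ∈ Set.Icc (0 : ℝ) 1)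
    (hφ : ∀ x, φ x ∈ Set.Icc (0 : ℝ) 1) (n : ℕ) {N : ℕ} (σ : Fin N → ℤˣ) (X : Fin N → Torus)
    (G : SimpleGraph (Fin N)) :
    graphProb p q φ n (σ, X, G) = ENNReal.ofReal (graphWeight (linkRate p q φ n X) σ G) := by
  classical
  unfold graphWeight graphProb
  rw [ENNReal.ofReal_prod_of_nonneg
    fun e _ => (linkWeight_mem (linkRate_mem hp hq hφ n X _ _ _) _).1]
  refine Finset.prod_congr rfl fun e he => ?_
  have hlt : e.1 < e.2 := by simpa using he
  rw [linkRate_mul_labels]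
  by_cases hG : G.Adj e.1 e.2
  · simp [hG, linkWeight, edgeCode, hlt]
  · simp [hG, linkWeight, edgeCode]

theorem measurable_psi (hφm : Measurable φ) (n : ℕ) :
    Measurable fun z : Torus × Torus => psi φ n z.1 z.2 := by
  unfold psi
  exact hφm.comp (measurable_real_toNNReal.comp (measurable_dist.const_mul _))

theorem measurable_linkWeight (z : Bool) : Measurable fun s : ℝ => linkWeight s z := by
  cases z
  · simpa [linkWeight] using (by fun_prop : Measurable fun s : ℝ => 1 - s)
  · simpa [linkWeight] using (by fun_prop : Measurable fun s : ℝ => s)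

theorem measurable_graphWeight (hφm : Measurable φ) (n : ℕ) {N : ℕ} (σ : Fin N → ℤˣ)
    (G : SimpleGraph (Fin N)) :
    Measurable fun X : Fin N → Torus => graphWeight (linkRate p q φ n X) σ G := by
  unfold graphWeight linkRate
  refine Finset.measurable_fun_prod _ fun e _ => (measurable_linkWeight _).comp ?_
  refine Measurable.const_mul ?_ _
  exact (measurable_psi hφm n).comp (f := fun X : Fin N → Torus => (X e.1, X e.2))
    ((measurable_pi_apply _).prodMk (measurable_pi_apply _))

theorem measurable_config {N : ℕ} {F : Config N → ℝ≥0∞}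
    (h : ∀ σ G, Measurable fun X => F (σ, X, G)) : Measurable F := by
  refine measurable_from_prod_countable_right fun σ => ?_
  exact measurable_from_prod_countable_left fun G => h σ G

theorem pi_uniformOn_singleton {N : ℕ} (σ : Fin N → ℤˣ) :
    (Measure.pi fun _ : Fin N => uniformOn (Set.univ : Set ℤˣ)) {σ} = ((2 : ℝ≥0∞)⁻¹) ^ N := by
  rw [Measure.pi_singleton]
  simp [uniformOn_univ]

theorem lintegral_config {N : ℕ} {F : Config N → ℝ≥0∞}
    (h : ∀ σ G, Measurable fun X => F (σ, X, G)) :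
    ∫⁻ ω, F ω ∂((Measure.pi fun _ : Fin N => uniformOn (Set.univ : Set ℤˣ)).prod
      ((Measure.pi fun _ : Fin N => (volume : Measure Torus)).prod
        (Measure.count : Measure (SimpleGraph (Fin N))))) =
      ∫⁻ X, (2 : ℝ≥0∞)⁻¹ ^ N * ∑ σ, ∑ G, F (σ, X, G)
        ∂(Measure.pi fun _ : Fin N => (volume : Measure Torus)) := by
  have hF := measurable_config h
  rw [lintegral_prod _ hF.aemeasurable, lintegral_fintype]
  simp_rw [pi_uniformOn_singleton]
  have e : ∀ σ : Fin N → ℤˣ, ∫⁻ y, F (σ, y) ∂((Measure.pi fun _ : Fin N =>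
      (volume : Measure Torus)).prod (Measure.count : Measure (SimpleGraph (Fin N)))) =
      ∫⁻ X, ∑ G, F (σ, X, G) ∂(Measure.pi fun _ : Fin N => (volume : Measure Torus)) := by
    intro σ
    rw [lintegral_prod (fun y => F (σ, y)) (hF.comp measurable_prodMk_left).aemeasurable]
    simp_rw [lintegral_count, tsum_fintype]
  simp_rw [e]
  have hm : ∀ σ, Measurable fun X => ∑ G, F (σ, X, G) :=
    fun σ => Finset.measurable_fun_sum _ fun G _ => h σ G
  rw [lintegral_const_mul _ (Finset.measurable_fun_sum _ fun σ _ => hm σ),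
    lintegral_finsetSum _ fun σ _ => hm σ, Finset.mul_sum]
  exact Finset.sum_congr rfl fun σ _ => mul_comm _ _

/-- The success event for a given number of nodes. -/
def successAt (T : Estimator) (N : ℕ) : Set (Config N) := Sigma.mk N ⁻¹' T.success

theorem measurableSet_successAt (T : Estimator) (N : ℕ) : MeasurableSet (successAt T N) := by
  have hest : Measurable fun ω : Config N => T.est N ω.2.1 ω.2.2 :=
    (T.measurable_est N).comp measurable_snd
  have h1 : Measurable fun ω : Config N => ω.1 := measurable_fst
  have h2 : Measurable fun ω : Config N => -ω.1 :=
    (measurable_of_countable fun σ : Fin N → ℤˣ => -σ).comp measurable_fst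
  exact (measurableSet_eq_fun hest h1).union (measurableSet_eq_fun hest h2)

theorem measurableSet_success (T : Estimator) : MeasurableSet T.success :=
  MeasurableSpace.measurableSet_iInf.2 fun N => measurableSet_successAt T N

open Classical in
/-- The conditional probability, given the locations, that no labelling other than the truth and
its negative is at least as likely as the truth. -/
noncomputable def rivalFreeProb (p q : ℝ) (φ : ℝ≥0 → ℝ) (n : ℕ) {N : ℕ} (X : Fin N → Torus) : ℝ :=
  (1 / 2) ^ N * ∑ σ : Fin N → ℤˣ, ∑ G, if ∃ σ', σ' ≠ σ ∧ σ' ≠ -σ ∧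
    graphWeight (linkRate p q φ n X) σ G ≤ graphWeight (linkRate p q φ n X) σ' G then 0
    else graphWeight (linkRate p q φ n X) σ G

theorem half_pow_mul_sum_graphWeight {N : ℕ} (r : Fin N → Fin N → ℤˣ → ℝ) :
    (1 / 2 : ℝ) ^ N * ∑ σ : Fin N → ℤˣ, ∑ G, graphWeight r σ G = 1 := by
  simp_rw [sum_graphWeight]
  simp

theorem rivalFreeProb_nonneg (hp : p ∈ Set.Icc (0 : ℝ) 1) (hq : q ∈ Set.Icc (0 : ℝ) 1)
    (hφ : ∀ x, φ x ∈ Set.Icc (0 : ℝ) 1) (n : ℕ) {N : ℕ} (X : Fin N → Torus) :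
    0 ≤ rivalFreeProb p q φ n X := by
  refine mul_nonneg (by positivity) (Finset.sum_nonneg fun σ _ => Finset.sum_nonneg fun G _ => ?_)
  split_ifs
  · exact le_rfl
  · exact graphWeight_nonneg (linkRate_mem hp hq hφ n X) σ G

/-- A bound on the rival-free probability by the mass outside any set of configurations that have
a rival. -/
theorem rivalFreeProb_le (hp : p ∈ Set.Icc (0 : ℝ) 1) (hq : q ∈ Set.Icc (0 : ℝ) 1)
    (hφ : ∀ x, φ x ∈ Set.Icc (0 : ℝ) 1) (n : ℕ) {N : ℕ} (X : Fin N → Torus)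
    (B : (Fin N → ℤˣ) → SimpleGraph (Fin N) → Prop) [∀ σ G, Decidable (B σ G)]
    (hB : ∀ σ G, B σ G → ∃ σ', σ' ≠ σ ∧ σ' ≠ -σ ∧
      graphWeight (linkRate p q φ n X) σ G ≤ graphWeight (linkRate p q φ n X) σ' G) :
    rivalFreeProb p q φ n X ≤ (1 / 2) ^ N * ∑ σ : Fin N → ℤˣ, ∑ G,
      if B σ G then 0 else graphWeight (linkRate p q φ n X) σ G := by
  refine mul_le_mul_of_nonneg_left (Finset.sum_le_sum fun σ _ => Finset.sum_le_sum fun G _ => ?_)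
    (by positivity)
  have h0 := graphWeight_nonneg (linkRate_mem hp hq hφ n X) σ G
  by_cases hb : B σ G
  · rw [if_pos (hB σ G hb), if_pos hb]
  · rw [if_neg hb]
    split_ifs
    · exact h0
    · exact le_rfl

theorem rivalFreeProb_le_one (hp : p ∈ Set.Icc (0 : ℝ) 1) (hq : q ∈ Set.Icc (0 : ℝ) 1)
    (hφ : ∀ x, φ x ∈ Set.Icc (0 : ℝ) 1) (n : ℕ) {N : ℕ} (X : Fin N → Torus) :
    rivalFreeProb p q φ n X ≤ 1 := by
  have h := rivalFreeProb_le hp hq hφ n X (fun _ _ => False) (by simp)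
  simpa [half_pow_mul_sum_graphWeight, ← one_div, -one_div] using h

/-- For each fixed location vector this is `sum_success_le`, with every labelling that has a rival
put into `B`, divided by 3 · 2^N; the total likelihood averages to one. -/
theorem condLaw_success_le (hp : p ∈ Set.Icc (0 : ℝ) 1) (hq : q ∈ Set.Icc (0 : ℝ) 1)
    (hφ : ∀ x, φ x ∈ Set.Icc (0 : ℝ) 1) (hφm : Measurable φ) (n N : ℕ) (T : Estimator) :
    condLaw p q φ n N (successAt T N) ≤
      ∫⁻ X, ENNReal.ofReal ((2 + rivalFreeProb p q φ n X) / 3)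
        ∂(Measure.pi fun _ : Fin N => (volume : Measure Torus)) := by
  classical
  have hS := measurableSet_successAt T N
  rw [condLaw, withDensity_apply _ hS, ← lintegral_indicator hS, lintegral_config]
  · refine lintegral_mono fun X => ?_
    have e : ∀ σ G, (successAt T N).indicator (graphProb p q φ n) (σ, X, G) =
        ENNReal.ofReal (if T.est N X G = σ ∨ T.est N X G = -σ then
          graphWeight (linkRate p q φ n X) σ G else 0) := by
      intro σ G
      have hiff : (σ, X, G) ∈ successAt T N ↔ (T.est N X G = σ ∨ T.est N X G = -σ) := Iff.rfl
      rw [Set.indicator_apply, graphProb_eq_ofReal hp hq hφ]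
      simp only [hiff]
      split_ifs <;> simp
    simp_rw [e]
    have h0 : ∀ σ G, 0 ≤ if T.est N X G = σ ∨ T.est N X G = -σ then
          graphWeight (linkRate p q φ n X) σ G else 0 := by
      intro σ G
      split_ifs
      · exact graphWeight_nonneg (linkRate_mem hp hq hφ n X) σ G
      · exact le_rfl
    have e2 : (2 : ℝ≥0∞)⁻¹ ^ N = ENNReal.ofReal ((1 / 2) ^ N) := by
      rw [ENNReal.ofReal_pow (by norm_num), one_div, ENNReal.ofReal_inv_of_pos (by norm_num)]
      simp
    have e3 : ∀ σ, ∑ G, ENNReal.ofReal (if T.est N X G = σ ∨ T.est N X G = -σ then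
          graphWeight (linkRate p q φ n X) σ G else 0) =
        ENNReal.ofReal (∑ G, if T.est N X G = σ ∨ T.est N X G = -σ then
          graphWeight (linkRate p q φ n X) σ G else 0) := fun σ =>
      (ENNReal.ofReal_sum_of_nonneg fun G _ => h0 σ G).symm
    simp_rw [e3]
    rw [← ENNReal.ofReal_sum_of_nonneg fun σ _ => Finset.sum_nonneg fun G _ => h0 σ G, e2,
      ← ENNReal.ofReal_mul (by positivity)]
    refine ENNReal.ofReal_le_ofReal ?_
    have h := sum_success_le (graphWeight (linkRate p q φ n X))
      (graphWeight_nonneg (linkRate_mem hp hq hφ n X)) (T.est N X) (fun σ => neg_neg σ)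
      (fun σ G => ∃ σ', σ' ≠ σ ∧ σ' ≠ -σ ∧
        graphWeight (linkRate p q φ n X) σ G ≤ graphWeight (linkRate p q φ n X) σ' G)
      (fun σ G h => h)
    have h' := mul_le_mul_of_nonneg_left h (by positivity : (0 : ℝ) ≤ (1 / 2) ^ N)
    have htot := half_pow_mul_sum_graphWeight (linkRate p q φ n X)
    unfold rivalFreeProb
    rw [mul_add, mul_left_comm, mul_left_comm _ (2 : ℝ), htot] at h'
    linarith
  · intro σ G
    simp_rw [Set.indicator_apply, graphProb_eq_ofReal hp hq hφ]
    refine Measurable.ite ?_ (measurable_graphWeight hφm n σ G).ennreal_ofReal measurable_const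
    have : Measurable fun X : Fin N → Torus => ((σ, X, G) : Config N) := by fun_prop
    exact this hS

theorem condLaw_success_le_one (hp : p ∈ Set.Icc (0 : ℝ) 1) (hq : q ∈ Set.Icc (0 : ℝ) 1)
    (hφ : ∀ x, φ x ∈ Set.Icc (0 : ℝ) 1) (hφm : Measurable φ) (n N : ℕ) (T : Estimator) :
    condLaw p q φ n N (successAt T N) ≤ 1 := by
  refine (condLaw_success_le hp hq hφ hφm n N T).trans ?_
  calc _ ≤ ∫⁻ _X, 1 ∂(Measure.pi fun _ : Fin N => (volume : Measure Torus)) := by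
        refine lintegral_mono fun X => ?_
        rw [← ENNReal.ofReal_one]
        have := rivalFreeProb_le_one hp hq hφ n X
        exact ENNReal.ofReal_le_ofReal (by linarith)
    _ = 1 := by simp

/-- If the rival-free probability is at most `D / H`, then the success probability is controlled
by the first two moments of `H`. -/
theorem condLaw_success_le_of_moments (hp : p ∈ Set.Icc (0 : ℝ) 1) (hq : q ∈ Set.Icc (0 : ℝ) 1)
    (hφ : ∀ x, φ x ∈ Set.Icc (0 : ℝ) 1) (hφm : Measurable φ) (n N : ℕ) (T : Estimator)
    {H : (Fin N → Torus) → ℝ} (hHm : Measurable H) {c D m s : ℝ} (hH : ∀ X, H X ∈ Set.Icc 0 c)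
    (hHD : ∀ X, rivalFreeProb p q φ n X * H X ≤ D) (hm : 0 < m)
    (hmean : ∫ X, H X ∂(Measure.pi fun _ => volume) = m)
    (hsq : ∫ X, H X ^ 2 ∂(Measure.pi fun _ => volume) ≤ s) :
    condLaw p q φ n N (successAt T N) ≤
      ENNReal.ofReal (2 / 3 + (4 * (s / m ^ 2 - 1) + 2 * D / m) / 3) := by
  refine (condLaw_success_le hp hq hφ hφm n N T).trans ?_
  -- Chebyshev in pointwise form: either H is at least half its mean and the bound D applies, or the
  -- squared deviation exceeds m²/4.
  have hpt : ∀ X, rivalFreeProb p q φ n X ≤ 4 / m ^ 2 * (H X - m) ^ 2 + 2 * D / m := by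
    intro X
    have h0 := rivalFreeProb_nonneg hp hq hφ n X
    have h1 := rivalFreeProb_le_one hp hq hφ n X
    have hD : 0 ≤ D := (mul_nonneg h0 (hH X).1).trans (hHD X)
    rcases le_or_gt (m / 2) (H X) with h | h
    · have h2 : rivalFreeProb p q φ n X * (m / 2) ≤ D :=
        (mul_le_mul_of_nonneg_left h h0).trans (hHD X)
      have h3 : rivalFreeProb p q φ n X ≤ 2 * D / m := by
        rw [le_div_iff₀ hm]; linarith
      have h4 : 0 ≤ 4 / m ^ 2 * (H X - m) ^ 2 := by positivity
      linarith
    · have h2 : 1 ≤ 4 / m ^ 2 * (H X - m) ^ 2 := by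
        rw [div_mul_eq_mul_div, le_div_iff₀ (by positivity)]
        nlinarith
      have h3 : 0 ≤ 2 * D / m := by positivity
      linarith
  have hiH : Integrable H (Measure.pi fun _ => volume) := integrable_of_mem_Icc hHm hH
  have hiH2 : Integrable (fun X => H X ^ 2) (Measure.pi fun _ => volume) :=
    integrable_of_mem_Icc (c := c ^ 2) (hHm.pow_const 2) fun X =>
      ⟨by positivity, pow_le_pow_left₀ (hH X).1 (hH X).2 2⟩
  have hint : Integrable (fun X => (2 + (4 / m ^ 2 * (H X - m) ^ 2 + 2 * D / m)) / 3)
      (Measure.pi fun _ : Fin N => (volume : Measure Torus)) := by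
    have : (fun X => (2 + (4 / m ^ 2 * (H X - m) ^ 2 + 2 * D / m)) / 3) = fun X =>
        (4 / m ^ 2 / 3) * H X ^ 2 + ((-(8 / m) / 3) * H X + (2 + 4 + 2 * D / m) / 3) := by
      ext X; field_simp; ring
    rw [this]
    exact (hiH2.const_mul _).add ((hiH.const_mul _).add (integrable_const _))
  calc _ ≤ ∫⁻ X, ENNReal.ofReal ((2 + (4 / m ^ 2 * (H X - m) ^ 2 + 2 * D / m)) / 3)
        ∂(Measure.pi fun _ : Fin N => (volume : Measure Torus)) := by
        refine lintegral_mono fun X => ENNReal.ofReal_le_ofReal ?_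
        have := hpt X
        linarith
    _ = ENNReal.ofReal (∫ X, (2 + (4 / m ^ 2 * (H X - m) ^ 2 + 2 * D / m)) / 3
        ∂(Measure.pi fun _ : Fin N => (volume : Measure Torus))) := by
        refine (ofReal_integral_eq_lintegral_ofReal hint (ae_of_all _ fun X => ?_)).symm
        have := hpt X
        have := rivalFreeProb_nonneg hp hq hφ n X
        change (0 : ℝ) ≤ _
        linarith
    _ ≤ _ := by
        refine ENNReal.ofReal_le_ofReal ?_
        have : (fun X => (2 + (4 / m ^ 2 * (H X - m) ^ 2 + 2 * D / m)) / 3) = fun X =>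
            (4 / m ^ 2 / 3) * H X ^ 2 + ((-(8 / m) / 3) * H X + (2 + 4 + 2 * D / m) / 3) := by
          ext X; field_simp; ring
        have i1 : Integrable (fun X => -(8 / m) / 3 * H X + (2 + 4 + 2 * D / m) / 3)
            (Measure.pi fun _ : Fin N => (volume : Measure Torus)) :=
          (hiH.const_mul _).add (integrable_const _)
        rw [this, integral_add (hiH2.const_mul _) i1,
          integral_add (hiH.const_mul _) (integrable_const _), integral_const_mul,
          integral_const_mul, hmean]
        simp only [integral_const, probReal_univ, smul_eq_mul, one_mul]
        have h1 : 4 / m ^ 2 / 3 * ∫ X, H X ^ 2 ∂(Measure.pi fun _ => volume) ≤ 4 / m ^ 2 / 3 * s :=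
          mul_le_mul_of_nonneg_left hsq (by positivity)
        have h2 : 4 / m ^ 2 / 3 * s + (-(8 / m) / 3 * m + (2 + 4 + 2 * D / m) / 3) =
            2 / 3 + (4 * (s / m ^ 2 - 1) + 2 * D / m) / 3 := by
          field_simp; ring
        linarith

end CondLaw


/-! ### Poisson concentration and the second-moment criterion -/

section Asymptotics

variable {p q : ℝ} {φ : ℝ≥0 → ℝ}

theorem law_success_eq (lam : ℝ≥0) (p q : ℝ) (φ : ℝ≥0 → ℝ) (n : ℕ) (T : Estimator) :
    law lam p q φ n T.success =
      ∑' N, poissonMeasure (lam * n) {N} * condLaw p q φ n N (successAt T N) := by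
  rw [law, Measure.sum_apply _ (measurableSet_success T)]
  refine tsum_congr fun N => ?_
  rw [Measure.smul_apply, smul_eq_mul, Measure.map_apply _ (measurableSet_success T)]
  · rfl
  · exact fun s hs => MeasurableSpace.measurableSet_iInf.1 hs N

theorem hasSum_poisson_mul_exp (r : ℝ≥0) (a : ℝ) :
    HasSum (fun N : ℕ => (Real.exp (-r) * r ^ N / N.factorial) * Real.exp (a * N))
      (Real.exp (r * (Real.exp a - 1))) := by
  have h := (NormedSpace.expSeries_div_hasSum_exp (𝔸 := ℝ) (r * Real.exp a)).mul_left
    (Real.exp (-r))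
  rw [← Real.exp_eq_exp_ℝ, ← Real.exp_add] at h
  have e1 : (fun N : ℕ => (Real.exp (-r) * r ^ N / N.factorial) * Real.exp (a * N)) =
      fun N : ℕ => Real.exp (-r) * ((r * Real.exp a) ^ N / N.factorial) := by
    ext N
    rw [mul_pow, ← Real.exp_nat_mul, mul_comm a]; ring
  have e2 : (r : ℝ) * (Real.exp a - 1) = -r + r * Real.exp a := by ring
  rw [e1, e2]
  exact h

theorem tendsto_exp_neg_mul_natCast {c : ℝ} (hc : 0 < c) :
    Tendsto (fun n : ℕ => Real.exp (-(c * n))) atTop (𝓝 0) :=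
  Real.tendsto_exp_neg_atTop_nhds_zero.comp
    (Tendsto.const_mul_atTop hc tendsto_natCast_atTop_atTop)

/-- For a large deviation of a Poisson variable from its mean the Chernoff exponent is positive. -/
theorem chernoff_exponent_pos {lam c : ℝ} (hlam : 0 < lam) (hc : 0 < c) (hne : c ≠ lam) :
    0 < c * Real.log (c / lam) - (c - lam) := by
  have h : Real.log (lam / c) < lam / c - 1 :=
    Real.log_lt_sub_one_of_pos (by positivity) fun h => hne ((div_eq_one_iff_eq hc.ne').1 h).symm
  rw [← inv_div, Real.log_inv] at h
  have := mul_lt_mul_of_pos_left h hc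
  have e : c * ((c / lam)⁻¹ - 1) = lam - c := by field_simp
  rw [e] at this
  linarith

/-- If for node numbers in a window around the mean the success probability stays below a
constant, then exact recovery fails. -/
theorem not_recoversExactly_of_window (lam : ℝ≥0) (hlam : 0 < lam) (hp : p ∈ Set.Icc (0 : ℝ) 1)
    (hq : q ∈ Set.Icc (0 : ℝ) 1) (hφ : ∀ x, φ x ∈ Set.Icc (0 : ℝ) 1) (hφm : Measurable φ)
    {c₁ c₂ : ℝ} (hc₁ : 0 < c₁) (h₁ : c₁ < lam) (h₂ : lam < c₂)
    (h : ∀ᶠ n : ℕ in atTop, ∀ N : ℕ, c₁ * n ≤ N → N ≤ c₂ * n → ∀ T : Estimator,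
      condLaw p q φ n N (successAt T N) ≤ ENNReal.ofReal (5 / 6))
    (T : ℕ → Estimator) : ¬ RecoversExactly lam p q φ T := by
  intro hT
  have hlam' : (0 : ℝ) < lam := hlam
  have hc₂ : 0 < c₂ := hlam'.trans h₂
  -- The optimal exponential tilts for the lower and upper Poisson tails; `d₁` and `d₂` are the
  -- resulting Chernoff exponents.
  set a₁ := Real.log (c₁ / lam) with ha₁
  set a₂ := Real.log (c₂ / lam) with ha₂
  have ha₁' : a₁ < 0 := Real.log_neg (by positivity) ((div_lt_one hlam').2 h₁)
  have ha₂' : 0 < a₂ := Real.log_pos ((one_lt_div hlam').2 h₂)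
  set d₁ := c₁ * a₁ - (c₁ - lam)
  set d₂ := c₂ * a₂ - (c₂ - lam)
  have hd₁ : 0 < d₁ := chernoff_exponent_pos hlam' hc₁ h₁.ne
  have hd₂ : 0 < d₂ := chernoff_exponent_pos hlam' hc₂ h₂.ne'
  have hbound : ∀ᶠ n : ℕ in atTop, law lam p q φ n (T n).success ≤
      ENNReal.ofReal (5 / 6 + (Real.exp (-(d₁ * n)) + Real.exp (-(d₂ * n)))) := by
    filter_upwards [h] with n hn
    -- A bound valid for every N: outside the window one of the two exponentials is at least 1. Its
    -- Poisson average is explicit.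
    let b : ℕ → ℝ := fun N => 5 / 6 + (Real.exp (-(a₁ * c₁ * n)) * Real.exp (a₁ * N) +
      Real.exp (-(a₂ * c₂ * n)) * Real.exp (a₂ * N))
    have hb0 : ∀ N, 0 ≤ b N := fun N => by positivity
    have hb : ∀ N, condLaw p q φ n N (successAt (T n) N) ≤ ENNReal.ofReal (b N) := by
      intro N
      by_cases hw : c₁ * n ≤ N ∧ (N : ℝ) ≤ c₂ * n
      · refine (hn N hw.1 hw.2 (T n)).trans (ENNReal.ofReal_le_ofReal ?_)
        have : 0 ≤ Real.exp (-(a₁ * c₁ * n)) * Real.exp (a₁ * N) +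
          Real.exp (-(a₂ * c₂ * n)) * Real.exp (a₂ * N) := by positivity
        simp only [b]; linarith
      · refine (condLaw_success_le_one hp hq hφ hφm n N (T n)).trans ?_
        rw [← ENNReal.ofReal_one]
        refine ENNReal.ofReal_le_ofReal ?_
        simp only [b]
        rw [← Real.exp_add, ← Real.exp_add]
        have e1 := Real.exp_pos (-(a₁ * c₁ * n) + a₁ * N)
        have e2 := Real.exp_pos (-(a₂ * c₂ * n) + a₂ * N)
        rcases not_and_or.1 hw with hw | hw
        · have : 1 ≤ Real.exp (-(a₁ * c₁ * n) + a₁ * N) := Real.one_le_exp (by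
            have := mul_le_mul_of_nonpos_left (not_le.1 hw).le ha₁'.le
            linarith)
          linarith
        · have : 1 ≤ Real.exp (-(a₂ * c₂ * n) + a₂ * N) := Real.one_le_exp (by
            have := mul_le_mul_of_nonneg_left (not_le.1 hw).le ha₂'.le
            linarith)
          linarith
    set r : ℝ≥0 := lam * n with hr
    have hrn : (r : ℝ) = lam * n := by simp [hr]
    have hs : HasSum (fun N : ℕ => (Real.exp (-r) * r ^ N / N.factorial) * b N)
        (5 / 6 + (Real.exp (-(d₁ * n)) + Real.exp (-(d₂ * n)))) := by
      have s0 := (hasSum_one_poissonMeasure r).mul_left (5 / 6 : ℝ)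
      have s1 := (hasSum_poisson_mul_exp r a₁).mul_left (Real.exp (-(a₁ * c₁ * n)))
      have s2 := (hasSum_poisson_mul_exp r a₂).mul_left (Real.exp (-(a₂ * c₂ * n)))
      have e1 : (fun N : ℕ => (Real.exp (-r) * r ^ N / N.factorial) * b N) = fun N : ℕ =>
          5 / 6 * (Real.exp (-r) * r ^ N / N.factorial) + (Real.exp (-(a₁ * c₁ * n)) *
            (Real.exp (-r) * r ^ N / N.factorial * Real.exp (a₁ * N)) + Real.exp (-(a₂ * c₂ * n)) *
            (Real.exp (-r) * r ^ N / N.factorial * Real.exp (a₂ * N))) := by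
        ext N; simp only [b]; ring
      have e2 : 5 / 6 + (Real.exp (-(d₁ * n)) + Real.exp (-(d₂ * n))) =
          5 / 6 * 1 + (Real.exp (-(a₁ * c₁ * n)) * Real.exp (r * (Real.exp a₁ - 1)) +
            Real.exp (-(a₂ * c₂ * n)) * Real.exp (r * (Real.exp a₂ - 1))) := by
        rw [← Real.exp_add, ← Real.exp_add, ha₁, ha₂, Real.exp_log (by positivity),
          Real.exp_log (by positivity), hrn, mul_one]
        congr 3
        · simp only [d₁, ha₁]; field_simp; ring
        · simp only [d₂, ha₂]; field_simp; ring
      rw [e1, e2]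
      exact s0.add (s1.add s2)
    rw [law_success_eq, ← hs.tsum_eq, ENNReal.ofReal_tsum_of_nonneg
      (fun N => mul_nonneg (by positivity) (hb0 N)) hs.summable]
    refine ENNReal.tsum_le_tsum fun N => ?_
    rw [ENNReal.ofReal_mul (by positivity), poissonMeasure_singleton]
    exact mul_le_mul_right (hb N) _
  have hlim : Tendsto (fun n : ℕ => ENNReal.ofReal
      (5 / 6 + (Real.exp (-(d₁ * n)) + Real.exp (-(d₂ * n))))) atTop
      (𝓝 (ENNReal.ofReal (5 / 6 + (0 + 0)))) :=
    ENNReal.tendsto_ofReal (((tendsto_exp_neg_mul_natCast hd₁).add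
      (tendsto_exp_neg_mul_natCast hd₂)).const_add _)
  have h1 := le_of_tendsto_of_tendsto hT hlim hbound
  rw [← ENNReal.ofReal_one, ENNReal.ofReal_le_ofReal_iff (by norm_num)] at h1
  norm_num at h1

/-- Raises `log (1 - t) ≥ 1 - 1 / (1 - t)` to the power N. -/
theorem exp_neg_le_one_sub_pow {t : ℝ} (h1 : t < 1) (N : ℕ) :
    Real.exp (-(N * (t / (1 - t)))) ≤ (1 - t) ^ N := by
  have h := Real.one_sub_inv_le_log_of_pos (sub_pos.2 h1)
  have e : 1 - (1 - t)⁻¹ = -(t / (1 - t)) := by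
    have : 1 - t ≠ 0 := (sub_pos.2 h1).ne'
    field_simp; ring
  rw [← mul_neg, Real.exp_nat_mul]
  refine pow_le_pow_left₀ (Real.exp_pos _).le ?_ N
  rw [← Real.le_log_iff_exp_le (sub_pos.2 h1)]
  linarith

theorem tendsto_log_div_natCast (a : ℝ) :
    Tendsto (fun n : ℕ => a * (Real.log n / n)) atTop (𝓝 0) := by
  have h : Tendsto (fun x : ℝ => Real.log x / x) atTop (𝓝 0) := by
    simpa using Real.isLittleO_log_id_atTop.tendsto_div_nhds_zero
  simpa using (h.comp tendsto_natCast_atTop_atTop).const_mul a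

/-- Second-moment criterion: if isolated points abound and each lack of a rival is controlled by
the isolation sum, then exact recovery fails. -/
theorem not_recoversExactly_of_isolation (lam : ℝ≥0) (hlam : 0 < lam)
    (hp : p ∈ Set.Icc (0 : ℝ) 1) (hq : q ∈ Set.Icc (0 : ℝ) 1)
    (hφ : ∀ x, φ x ∈ Set.Icc (0 : ℝ) 1) (hφm : Measurable φ) {a γ D : ℝ} (ha : 0 < a)
    (hlama : lam * a < 1) (hγ : 0 < γ)
    (h : ∀ᶠ n : ℕ in atTop, ∃ (C : Set Torus) (g : Torus → Torus → ℝ) (α : ℝ),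
      MeasurableSet C ∧ Measurable (Function.uncurry g) ∧ (∀ x y, g x y ∈ Set.Icc (0 : ℝ) 1) ∧
      γ ≤ volume.real C ∧ (∀ x, ∫ y, (1 - g x y) = α) ∧ α ≤ a * (Real.log n / n) ∧
      (∀ x ∈ C, ∀ y ∈ C, g x y ≠ 0 → g y x ≠ 0 → ∀ z, (1 - g x z) * (1 - g y z) = 0) ∧
      ∀ N, 2 ≤ N → ∀ X : Fin N → Torus,
        rivalFreeProb p q φ n X * isolationSum C g X ≤ D)
    (T : ℕ → Estimator) : ¬ RecoversExactly lam p q φ T := by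
  have hlam' : (0 : ℝ) < lam := hlam
  -- Room for the upper end of the window, and then a number b with c₂a < b < 1 that absorbs the
  -- correction 1/(1 - t).
  obtain ⟨c₂, hc₂, hc₂a⟩ : ∃ c₂ : ℝ, lam < c₂ ∧ c₂ * a < 1 := by
    obtain ⟨c, h1, h2⟩ := exists_between ((lt_div_iff₀ ha).2 hlama)
    exact ⟨c, h1, (lt_div_iff₀ ha).1 h2⟩
  obtain ⟨b, hb1, hb2⟩ := exists_between hc₂a
  have hc₂0 : 0 < c₂ := hlam'.trans hc₂
  have hc₁ : (0 : ℝ) < lam / 2 := by positivity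
  refine not_recoversExactly_of_window lam hlam hp hq hφ hφm hc₁ (by linarith) hc₂ ?_ T
  set t : ℕ → ℝ := fun n => a * (Real.log n / n) with ht
  -- A lower bound (λ/2) γ n^(1 - b) for the mean of the isolation sum, uniform over the window.
  set M : ℕ → ℝ := fun n => lam / 2 * γ * Real.exp ((1 - b) * Real.log n) with hM
  have htlim : Tendsto t atTop (𝓝 0) := tendsto_log_div_natCast a
  have hloglim : Tendsto (fun n : ℕ => Real.log n) atTop atTop :=
    Real.tendsto_log_atTop.comp tendsto_natCast_atTop_atTop
  have hMlim : Tendsto M atTop atTop :=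
    (Real.tendsto_exp_atTop.comp (hloglim.const_mul_atTop (by linarith))).const_mul_atTop
      (by positivity)
  have hMinv : Tendsto (fun n => (M n)⁻¹) atTop (𝓝 0) := hMlim.inv_tendsto_atTop
  -- The limit is 2/3, strictly below the target 5/6.
  have hebound : Tendsto (fun n => 2 / 3 + (4 * ((M n)⁻¹ + ((1 - t n) ^ 2)⁻¹ - 1) +
      2 * |D| * (M n)⁻¹) / 3) atTop (𝓝 (2 / 3 + (4 * (0 + ((1 - 0) ^ 2)⁻¹ - 1) +
      2 * |D| * 0) / 3)) := by
    refine Tendsto.const_add _ (Tendsto.div_const (Tendsto.add (Tendsto.const_mul _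
      ((hMinv.add ((((htlim.const_sub 1).pow 2)).inv₀ (by norm_num))).sub_const _))
        (hMinv.const_mul _)) _)
  have hev1 := hebound.eventually_lt_const (u := 5 / 6) (by norm_num)
  have hev2 : ∀ᶠ n in atTop, c₂ * a / (1 - t n) < b := by
    have : Tendsto (fun n => c₂ * a / (1 - t n)) atTop (𝓝 (c₂ * a / (1 - 0))) :=
      tendsto_const_nhds.div (htlim.const_sub 1) (by norm_num)
    exact this.eventually_lt_const (by simpa using hb1)
  have hev3 : ∀ᶠ n in atTop, t n < 1 := htlim.eventually_lt_const (by norm_num)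
  have hev4 : ∀ᶠ n : ℕ in atTop, 2 ≤ lam / 2 * (n : ℝ) :=
    (tendsto_natCast_atTop_atTop.const_mul_atTop hc₁).eventually_ge_atTop 2
  filter_upwards [h, hev1, hev2, hev3, hev4, eventually_ge_atTop 2] with n hn he1 he2 he3 he4 hn2
  intro N hN1 hN2 T
  obtain ⟨C, g, α, hC, hgm, hg, hγC, hα, hαt, hsep, hrival⟩ := hn
  have hN2' : 2 ≤ N := by
    have : (2 : ℝ) ≤ N := he4.trans hN1
    exact_mod_cast this
  obtain ⟨L, rfl⟩ : ∃ L, N = L + 2 := ⟨N - 2, by omega⟩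
  have hn0 : (0 : ℝ) < n := by positivity
  have hlog : 0 ≤ Real.log n := Real.log_natCast_nonneg n
  have ht0 : 0 ≤ t n := by positivity
  have hα0 : 0 ≤ α := by
    rw [← hα 0]
    exact integral_nonneg fun y => sub_nonneg.2 (hg _ _).2
  have ht1 : 0 < 1 - t n := by linarith
  have h1t : 1 - t n ≤ 1 - α := by linarith [show α ≤ t n from hαt]
  have h1α : 0 < 1 - α := ht1.trans_le h1t
  have hv : 0 < volume.real C := hγ.trans_le hγC
  set m : ℝ := ((L : ℝ) + 2) * (volume.real C * (1 - α) ^ (L + 1)) with hm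
  have hm0 : 0 < m := by positivity
  have hMm : M n ≤ m := by
    have h1 : (1 - t n) ^ (L + 2) ≤ (1 - α) ^ (L + 1) :=
      (pow_le_pow_left₀ ht1.le h1t _).trans
        (pow_le_pow_of_le_one h1α.le (by linarith) (by omega))
    have h2 : Real.exp (-(b * Real.log n)) ≤ (1 - t n) ^ (L + 2) := by
      refine le_trans (Real.exp_le_exp.2 (neg_le_neg ?_)) (exp_neg_le_one_sub_pow he3 _)
      calc ((L + 2 : ℕ) : ℝ) * (t n / (1 - t n)) ≤ c₂ * n * (t n / (1 - t n)) :=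
            mul_le_mul_of_nonneg_right hN2 (by positivity)
        _ = c₂ * a / (1 - t n) * Real.log n := by
            simp only [ht]; field_simp
        _ ≤ b * Real.log n := mul_le_mul_of_nonneg_right he2.le hlog
    have h3 : M n = lam / 2 * n * (γ * Real.exp (-(b * Real.log n))) := by
      simp only [hM]
      rw [sub_mul, one_mul, sub_eq_add_neg, Real.exp_add, Real.exp_log hn0]; ring
    rw [h3]
    have hN1' : lam / 2 * (n : ℝ) ≤ L + 2 := by exact_mod_cast hN1
    exact mul_le_mul hN1' (mul_le_mul hγC (h2.trans h1) (Real.exp_pos _).le hv.le)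
      (by positivity) (by positivity)
  have hMpos : 0 < M n := by positivity
  have hmean := integral_isolationSum (volume : Measure Torus) hC hgm hg hα (M := L + 1)
  have hsq := integral_isolationSum_sq_le (volume : Measure Torus) hC hgm hg hα hsep (L := L)
  refine (condLaw_success_le_of_moments hp hq hφ hφm n (L + 2) T
    (measurable_isolationSum hC hgm) (D := D) (m := m) (fun X => isolationSum_mem hg X)
    (fun X => hrival _ hN2' X) hm0 (hmean.trans ?_) hsq).trans (ENNReal.ofReal_le_ofReal ?_)
  · rw [hm]; push_cast; ring
  refine le_trans ?_ he1.le
  -- The diagonal of the second moment contributes 1/m. The off-diagonal part has two factors (1 -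
  -- α)² fewer than two exponents L + 1 would give, hence (1 - α)⁻², which tends to 1.
  have e1 : (((L : ℝ) + 2) * (volume.real C * (1 - α) ^ (L + 1)) +
      (L + 2) ^ 2 * (volume.real C ^ 2 * ((1 - α) ^ 2) ^ L)) / m ^ 2 =
      m⁻¹ + ((1 - α) ^ 2)⁻¹ := by
    rw [hm, pow_right_comm, pow_succ]
    have : (L : ℝ) + 2 ≠ 0 := by positivity
    field_simp
  rw [e1]
  have h1 : m⁻¹ ≤ (M n)⁻¹ := inv_anti₀ hMpos hMm
  have h2 : ((1 - α) ^ 2)⁻¹ ≤ ((1 - t n) ^ 2)⁻¹ :=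
    inv_anti₀ (by positivity) (pow_le_pow_left₀ ht1.le h1t 2)
  have h3 : 2 * D / m ≤ 2 * |D| * (M n)⁻¹ := by
    rw [div_eq_mul_inv]
    calc 2 * D * m⁻¹ ≤ 2 * |D| * m⁻¹ :=
          mul_le_mul_of_nonneg_right (by linarith [le_abs_self D]) (by positivity)
      _ ≤ _ := mul_le_mul_of_nonneg_left h1 (by positivity)
  linarith

end Asymptotics


/-! ### Norm, multiples and radial integrals on the circle -/

section TorusGeometry

theorem exists_coe_eq_abs_eq_norm (z : Torus) :
    ∃ t : ℝ, (t : Torus) = z ∧ |t| = ‖z‖ ∧ |t| ≤ 1 / 2 := by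
  obtain ⟨x, rfl⟩ := QuotientAddGroup.mk_surjective z
  refine ⟨x - round x, ?_, ?_, abs_sub_round x⟩
  · rw [AddCircle.coe_sub]
    have : ((round x : ℝ) : Torus) = 0 := by
      exact (AddCircle.coe_eq_zero_iff (1 : ℝ)).2 ⟨round x, by simp⟩
    rw [this, sub_zero]
  · exact UnitAddCircle.norm_eq.symm

theorem norm_coe_torus {t : ℝ} (h : |t| ≤ 1 / 2) : ‖(t : Torus)‖ = |t| :=
  (AddCircle.norm_coe_eq_abs_iff (1 : ℝ) one_ne_zero).2 (by simpa using h)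

/-- As long as the multiple does not go beyond half the circle, nothing wraps around. -/
theorem norm_nsmul_torus {M : ℕ} {z : Torus} (h : M * ‖z‖ ≤ 1 / 2) : ‖M • z‖ = M * ‖z‖ := by
  obtain ⟨t, rfl, ht, -⟩ := exists_coe_eq_abs_eq_norm z
  have e : M • (t : Torus) = ((M * t : ℝ) : Torus) := by
    rw [← AddCircle.coe_nsmul, nsmul_eq_mul]
  rw [e, ← ht, norm_coe_torus, abs_mul, Nat.abs_cast]
  rw [abs_mul, Nat.abs_cast, ht]
  exact h

theorem volume_real_closedBall_torus {ε : ℝ} (h0 : 0 ≤ ε) :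
    volume.real (Metric.closedBall (0 : Torus) ε) = min 1 (2 * ε) := by
  rw [Measure.real, AddCircle.volume_closedBall, ENNReal.toReal_ofReal (by positivity)]

theorem measurePreserving_nsmul_torus {M : ℕ} (hM : M ≠ 0) :
    MeasurePreserving (fun z : Torus => M • z) := by
  have h := Measure.measurePreserving_zsmul (volume : Measure Torus) (n := (M : ℤ))
    (by exact_mod_cast hM)
  simpa using h

/-- Points whose `M`-th multiple is close to zero form well separated clusters. -/
theorem dist_le_of_nsmul_norm_le {M : ℕ} {ε : ℝ} {x y : Torus} (hM : 0 < M)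
    (hx : ‖M • x‖ ≤ ε) (hy : ‖M • y‖ ≤ ε) (h : M * dist x y ≤ 1 / 2) :
    dist x y ≤ 2 * ε / M := by
  rw [dist_eq_norm] at h ⊢
  have h1 := norm_nsmul_torus h
  have h2 : ‖M • (x - y)‖ ≤ ε + ε := by
    rw [smul_sub]
    exact (norm_sub_le _ _).trans (add_le_add hx hy)
  have hM' : (0 : ℝ) < M := by exact_mod_cast hM
  rw [le_div_iff₀ hM']
  linarith

/-- On the fundamental domain (-1/2, 1/2] the norm is |t|, and evenness folds the integral in two.
-/
theorem integral_norm_torus (F : ℝ → ℝ) :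
    ∫ z : Torus, F ‖z‖ = 2 * ∫ t in Set.Ioc 0 (1 / 2), F t := by
  rw [← UnitAddCircle.integral_preimage (-1 / 2) fun z => F ‖z‖]
  have e1 : ∫ t in Set.Ioc (-1 / 2 : ℝ) (-1 / 2 + 1), F ‖(t : Torus)‖ =
      ∫ t : ℝ, (Set.Iic (1 / 2 : ℝ)).indicator F |t| := by
    have e3 : ∫ t : ℝ, (Set.Iic (1 / 2 : ℝ)).indicator F |t| =
        ∫ t : ℝ, (Set.Icc (-1 / 2 : ℝ) (-1 / 2 + 1)).indicator (fun t => F |t|) t := by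
      refine integral_congr_ae (ae_of_all _ fun t => ?_)
      have : |t| ∈ Set.Iic (1 / 2 : ℝ) ↔ t ∈ Set.Icc (-1 / 2 : ℝ) (-1 / 2 + 1) := by
        rw [Set.mem_Iic, abs_le, Set.mem_Icc]; norm_num
      simp only [Set.indicator_apply, this]
    rw [e3, integral_indicator measurableSet_Icc, integral_Icc_eq_integral_Ioc]
    refine setIntegral_congr_fun measurableSet_Ioc fun t ht => ?_
    have : |t| ≤ 1 / 2 := by
      rw [abs_le]; constructor <;> linarith [ht.1, ht.2]
    simp only [norm_coe_torus this]
  rw [e1, integral_comp_abs, setIntegral_indicator measurableSet_Iic, Set.Ioi_inter_Iic]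

end TorusGeometry

/-! ### Bhattacharyya coefficients and the information metric -/

section Affinity

theorem affinity_nonneg (s t : ℝ) : 0 ≤ affinity s t := by
  unfold affinity; positivity

theorem affinity_zero_zero : affinity 0 0 = 1 := by simp [affinity]

theorem affinity_le_one {s t : ℝ} (hs : s ∈ Set.Icc (0 : ℝ) 1) (ht : t ∈ Set.Icc (0 : ℝ) 1) :
    affinity s t ≤ 1 := by
  obtain ⟨hs0, hs1⟩ := hs
  obtain ⟨ht0, ht1⟩ := ht
  have h1 : √(s * t) ≤ (s + t) / 2 :=
    Real.sqrt_le_iff.2 ⟨by linarith, by nlinarith [sq_nonneg (s - t)]⟩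
  have h2 : √((1 - s) * (1 - t)) ≤ (1 - s + (1 - t)) / 2 :=
    Real.sqrt_le_iff.2 ⟨by linarith, by nlinarith [sq_nonneg (s - t)]⟩
  unfold affinity
  linarith

variable {p q : ℝ} {φ : ℝ≥0 → ℝ}

/-- The information lost about a link by flipping one label, at scaled distance `x`. -/
noncomputable def linkInfo (p q : ℝ) (φ : ℝ≥0 → ℝ) (x : ℝ) : ℝ :=
  1 - affinity (p * φ x.toNNReal) (q * φ x.toNNReal)

theorem infoMetric_eq (hφ : ∀ x, φ x ∈ Set.Icc (0 : ℝ) 1) :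
    infoMetric φ p q = 2 * ∫ x in Set.Ioi (0 : ℝ), linkInfo p q φ x := by
  unfold infoMetric linkInfo affinity
  congr 2
  ext x
  have h0 := (hφ x.toNNReal).1
  have : √(p * φ x.toNNReal * (q * φ x.toNNReal)) = √(p * q) * φ x.toNNReal := by
    rw [show p * φ x.toNNReal * (q * φ x.toNNReal) = p * q * (φ x.toNNReal) ^ 2 by ring,
      Real.sqrt_mul' _ (by positivity), Real.sqrt_sq h0]
  rw [this]; ring

theorem linkInfo_mem (hp : p ∈ Set.Icc (0 : ℝ) 1) (hq : q ∈ Set.Icc (0 : ℝ) 1)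
    (hφ : ∀ x, φ x ∈ Set.Icc (0 : ℝ) 1) (x : ℝ) : linkInfo p q φ x ∈ Set.Icc (0 : ℝ) 1 := by
  have h1 := affinity_le_one (mul_mem_Icc hp (hφ x.toNNReal)) (mul_mem_Icc hq (hφ x.toNNReal))
  have h0 := affinity_nonneg (p * φ x.toNNReal) (q * φ x.toNNReal)
  constructor <;> unfold linkInfo <;> linarith

theorem measurable_linkInfo (hφm : Measurable φ) : Measurable (linkInfo p q φ) := by
  unfold linkInfo affinity
  have : Measurable fun x : ℝ => φ x.toNNReal := hφm.comp measurable_real_toNNReal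
  fun_prop

theorem linkInfo_eq_zero {κ : ℝ} (hκ : ∀ x : ℝ≥0, κ < x → φ x = 0) {x : ℝ} (hx0 : 0 ≤ x)
    (hx : κ < x) : linkInfo p q φ x = 0 := by
  have : φ x.toNNReal = 0 := hκ _ (by rwa [Real.coe_toNNReal _ hx0])
  simp [linkInfo, this, affinity_zero_zero]

theorem integrableOn_linkInfo (hp : p ∈ Set.Icc (0 : ℝ) 1) (hq : q ∈ Set.Icc (0 : ℝ) 1)
    (hφ : ∀ x, φ x ∈ Set.Icc (0 : ℝ) 1) (hφm : Measurable φ) {κ : ℝ}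
    (hκ : ∀ x : ℝ≥0, κ < x → φ x = 0) : IntegrableOn (linkInfo p q φ) (Set.Ioi 0) := by
  refine IntegrableOn.of_forall_sdiff_eq_zero (s := Set.Ioc 0 κ) ?_ measurableSet_Ioi ?_
  · exact integrable_of_mem_Icc (measurable_linkInfo hφm) (linkInfo_mem hp hq hφ)
  · rintro x ⟨hx, hx'⟩
    have hx0 : 0 < x := hx
    refine linkInfo_eq_zero hκ hx0.le ?_
    by_contra h
    exact hx' ⟨hx0, not_lt.1 h⟩

/-- Extending the radial integral from (0, 1/2] to the half-line only increases it; the scaling by s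
then produces s⁻¹. -/
theorem integral_linkInfo_le (hp : p ∈ Set.Icc (0 : ℝ) 1) (hq : q ∈ Set.Icc (0 : ℝ) 1)
    (hφ : ∀ x, φ x ∈ Set.Icc (0 : ℝ) 1) (hφm : Measurable φ) {κ : ℝ}
    (hκ : ∀ x : ℝ≥0, κ < x → φ x = 0) {s : ℝ} (hs : 0 < s) :
    ∫ z : Torus, linkInfo p q φ (s * ‖z‖) ≤ s⁻¹ * infoMetric φ p q := by
  rw [integral_norm_torus fun t => linkInfo p q φ (s * t), infoMetric_eq hφ]
  have hi := integrableOn_linkInfo hp hq hφ hφm hκ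
  have hi' : IntegrableOn (fun t => linkInfo p q φ (s * t)) (Set.Ioi 0) := by
    rw [integrableOn_Ioi_comp_mul_left_iff _ _ hs, mul_zero]
    exact hi
  have h1 : ∫ t in Set.Ioc 0 (1 / 2), linkInfo p q φ (s * t) ≤
      ∫ t in Set.Ioi 0, linkInfo p q φ (s * t) :=
    setIntegral_mono_set hi' (ae_of_all _ fun t => (linkInfo_mem hp hq hφ _).1)
      (LE.le.eventuallyLE Set.Ioc_subset_Ioi_self)
  rw [integral_comp_mul_left_Ioi _ _ hs, mul_zero, smul_eq_mul] at h1
  linarith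

theorem infoMetric_nonneg (hp : p ∈ Set.Icc (0 : ℝ) 1) (hq : q ∈ Set.Icc (0 : ℝ) 1)
    (hφ : ∀ x, φ x ∈ Set.Icc (0 : ℝ) 1) : 0 ≤ infoMetric φ p q := by
  rw [infoMetric_eq hφ]
  exact mul_nonneg zero_le_two (integral_nonneg fun x => (linkInfo_mem hp hq hφ x).1)

end Affinity

/-! ### Single-label flips at separated nodes -/

section FlipNode

variable {p q : ℝ} {φ : ℝ≥0 → ℝ}

/-- The isolation kernel of a node: zero at distance at most `ρ`, the reduced affinity of a link up
to distance `R`, and one beyond. -/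
noncomputable def flipKernel (p q : ℝ) (φ : ℝ≥0 → ℝ) (s δ ρ R : ℝ) (d : ℝ) : ℝ :=
  if d ≤ ρ then 0 else if d ≤ R then max 0 (1 - linkInfo p q φ (s * d) - δ) else 1

theorem flipKernel_mem (hp : p ∈ Set.Icc (0 : ℝ) 1) (hq : q ∈ Set.Icc (0 : ℝ) 1)
    (hφ : ∀ x, φ x ∈ Set.Icc (0 : ℝ) 1) {δ : ℝ} (hδ : 0 ≤ δ) (s ρ R d : ℝ) :
    flipKernel p q φ s δ ρ R d ∈ Set.Icc (0 : ℝ) 1 := by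
  unfold flipKernel
  have h := (linkInfo_mem hp hq hφ (s * d)).1
  split_ifs
  · simp
  · exact ⟨le_max_left _ _, max_le zero_le_one (by linarith)⟩
  · simp

theorem measurable_flipKernel (hφm : Measurable φ) (s δ ρ R : ℝ) :
    Measurable (flipKernel p q φ s δ ρ R) := by
  unfold flipKernel
  refine Measurable.ite measurableSet_Iic measurable_const
    (Measurable.ite measurableSet_Iic (measurable_const.max ?_) measurable_const)
  have := (measurable_linkInfo (p := p) (q := q) hφm).comp (measurable_const_mul s)
  exact (measurable_const.sub this).sub measurable_const

/-- This is the rate α. Apart from the information term, the exclusion zone costs at most 2ρ and the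
loss δ on the ball of radius R at most 2Rδ; both become negligible multiples of log n / n as δ
shrinks. -/
theorem integral_one_sub_flipKernel_le (hp : p ∈ Set.Icc (0 : ℝ) 1) (hq : q ∈ Set.Icc (0 : ℝ) 1)
    (hφ : ∀ x, φ x ∈ Set.Icc (0 : ℝ) 1) (hφm : Measurable φ) {κ : ℝ}
    (hκ : ∀ x : ℝ≥0, κ < x → φ x = 0) {s δ ρ R : ℝ} (hs : 0 < s) (hδ : 0 ≤ δ) (hρ : 0 ≤ ρ)
    (hR : 0 ≤ R) :
    ∫ z : Torus, (1 - flipKernel p q φ s δ ρ R ‖z‖) ≤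
      2 * ρ + δ * (2 * R) + s⁻¹ * infoMetric φ p q := by
  have hm := (measurable_linkInfo (p := p) (q := q) hφm).comp (measurable_const_mul s)
  have i1 : Integrable ((Metric.closedBall (0 : Torus) ρ).indicator (1 : Torus → ℝ)) :=
    (integrable_indicator_iff Metric.isClosed_closedBall.measurableSet).2
      (integrable_const _).integrableOn
  have i2 : Integrable (fun z => δ *
      (Metric.closedBall (0 : Torus) R).indicator (1 : Torus → ℝ) z) :=
    Integrable.const_mul ((integrable_indicator_iff
      Metric.isClosed_closedBall.measurableSet).2 (integrable_const _).integrableOn) _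
  have i3 : Integrable (fun z : Torus => linkInfo p q φ (s * ‖z‖)) :=
    integrable_of_mem_Icc (hm.comp measurable_norm) fun z => linkInfo_mem hp hq hφ _
  have hpt : ∀ z : Torus, 1 - flipKernel p q φ s δ ρ R ‖z‖ ≤
      (Metric.closedBall (0 : Torus) ρ).indicator 1 z +
        δ * (Metric.closedBall (0 : Torus) R).indicator 1 z + linkInfo p q φ (s * ‖z‖) := by
    intro z
    have h0 := (linkInfo_mem hp hq hφ (s * ‖z‖)).1
    have hi := (indicator_one_mem (Metric.closedBall (0 : Torus) ρ) z).1
    have hi' := mul_nonneg hδ (indicator_one_mem (Metric.closedBall (0 : Torus) R) z).1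
    unfold flipKernel
    split_ifs with h1 h2
    · have : z ∈ Metric.closedBall (0 : Torus) ρ := by simpa using h1
      rw [Set.indicator_of_mem this, Pi.one_apply]
      linarith
    · have : z ∈ Metric.closedBall (0 : Torus) R := by simpa using h2
      rw [Set.indicator_of_mem this, Pi.one_apply]
      have := le_max_right 0 (1 - linkInfo p q φ (s * ‖z‖) - δ)
      linarith
    · linarith
  have hfm := (measurable_flipKernel (p := p) (q := q) hφm s δ ρ R).comp
    (measurable_norm (α := Torus))
  have i4 : Integrable (fun z : Torus => 1 - flipKernel p q φ s δ ρ R ‖z‖) :=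
    (integrable_const _).sub
      (integrable_of_mem_Icc hfm fun z => flipKernel_mem hp hq hφ hδ _ _ _ _)
  refine (integral_mono i4 ((i1.add i2).add i3) hpt).trans ?_
  have e : ∫ z : Torus, ((Metric.closedBall (0 : Torus) ρ).indicator 1 z +
        δ * (Metric.closedBall (0 : Torus) R).indicator 1 z + linkInfo p q φ (s * ‖z‖)) =
      min 1 (2 * ρ) + δ * min 1 (2 * R) + ∫ z : Torus, linkInfo p q φ (s * ‖z‖) := by
    rw [integral_add (f := fun z => (Metric.closedBall (0 : Torus) ρ).indicator 1 z +
        δ * (Metric.closedBall (0 : Torus) R).indicator 1 z) (i1.add i2) i3,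
      integral_add i1 i2, integral_const_mul,
      integral_indicator_one Metric.isClosed_closedBall.measurableSet,
      integral_indicator_one Metric.isClosed_closedBall.measurableSet,
      volume_real_closedBall_torus hρ, volume_real_closedBall_torus hR]
  refine e.le.trans ?_
  have h1 := integral_linkInfo_le hp hq hφ hφm hκ hs
  have h2 := min_le_right 1 (2 * ρ)
  have h3 := mul_le_mul_of_nonneg_left (min_le_right 1 (2 * R)) hδ
  linarith

theorem flipLabel_ne {N : ℕ} (σ : Fin N → ℤˣ) (i : Fin N) : flipLabel σ i ≠ σ := by
  intro h
  have := congrFun h i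
  simp [flipLabel] at this

theorem flipLabel_ne_neg {N : ℕ} (hN : 2 ≤ N) (σ : Fin N → ℤˣ) (i : Fin N) :
    flipLabel σ i ≠ -σ := by
  intro h
  have : Nontrivial (Fin N) := Fin.nontrivial_iff_two_le.2 hN
  obtain ⟨j, hj⟩ := exists_ne i
  have := congrFun h j
  simp [flipLabel, hj] at this

/-- The product is at most exp(-cH) with H the sum, and x exp(-x) ≤ 1. -/
theorem mul_prod_le_inv {ι : Type*} (S : Finset ι) (f : ι → ℝ) {c : ℝ} (hc : 0 < c) (hc1 : c ≤ 1)
    (hf : ∀ i, f i ∈ Set.Icc (0 : ℝ) 1) :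
    (∏ i ∈ S, (1 - c * f i)) * ∑ i ∈ S, f i ≤ c⁻¹ := by
  have h0 : 0 ≤ ∑ i ∈ S, f i := Finset.sum_nonneg fun i _ => (hf i).1
  have h1 : ∏ i ∈ S, (1 - c * f i) ≤ Real.exp (-(c * ∑ i ∈ S, f i)) := by
    rw [Finset.mul_sum, ← Finset.sum_neg_distrib, Real.exp_sum]
    refine Finset.prod_le_prod (fun i _ => ?_) fun i _ => ?_
    · have := mul_le_one₀ hc1 (hf i).1 (hf i).2
      linarith
    · exact Real.one_sub_le_exp_neg _
  refine (mul_le_mul_of_nonneg_right h1 h0).trans ?_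
  have h2 := Real.add_one_le_exp (c * ∑ i ∈ S, f i)
  have h3 : Real.exp (-(c * ∑ i ∈ S, f i)) * Real.exp (c * ∑ i ∈ S, f i) = 1 := by
    rw [← Real.exp_add]; simp
  have h4 := Real.exp_pos (-(c * ∑ i ∈ S, f i))
  rw [← one_div, le_div_iff₀ hc]
  nlinarith

/-- Well separated nodes with few informative neighbours produce rivals by flipping one label. -/
theorem rivalFreeProb_mul_isolationSum_le (hp : p ∈ Set.Icc (0 : ℝ) 1)
    (hq : q ∈ Set.Icc (0 : ℝ) 1) (hφ : ∀ x, φ x ∈ Set.Icc (0 : ℝ) 1) {κ : ℝ}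
    (hκ : ∀ x : ℝ≥0, κ < x → φ x = 0) {n : ℕ} {δ ρ R : ℝ} (hδ : 0 < δ)
    (hR : 0 ≤ R) (hκR : ∀ d, R < d → κ < (n : ℝ) / Real.log n * d)
    {C : Set Torus} (hC : ∀ x ∈ C, ∀ y ∈ C, dist x y ≤ 2 * R → dist x y ≤ ρ) {N : ℕ}
    (hN : 2 ≤ N) (X : Fin N → Torus) :
    rivalFreeProb p q φ n X *
      isolationSum C (fun x y => flipKernel p q φ ((n : ℝ) / Real.log n) δ ρ R ‖x - y‖) X ≤
        (Real.exp (-(8 / δ) / 4) / 2)⁻¹ := by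
  classical
  set g : Torus → Torus → ℝ :=
    fun x y => flipKernel p q φ ((n : ℝ) / Real.log n) δ ρ R ‖x - y‖ with hg
  have hgm : ∀ x y, g x y ∈ Set.Icc (0 : ℝ) 1 := fun x y => flipKernel_mem hp hq hφ hδ.le _ _ _ _
  set h := fun i => isolationWeight C g X i with hh
  have hmem : ∀ i, h i ∈ Set.Icc (0 : ℝ) 1 := fun i => isolationWeight_mem hgm X i
  set S : Finset (Fin N) := Finset.univ.filter fun i => h i ≠ 0 with hS
  set A : Fin N → Finset (Fin N) := fun i =>
    Finset.univ.filter fun j => j ≠ i ∧ ‖X i - X j‖ ≤ R with hA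
  have hSC : ∀ i ∈ S, X i ∈ C := by
    intro i hi
    by_contra hn
    exact (Finset.mem_filter.1 hi).2 (by simp [hh, isolationWeight, hn])
  have hSg : ∀ i ∈ S, ∀ j, j ≠ i → g (X i) (X j) ≠ 0 := by
    intro i hi j hj h0
    refine (Finset.mem_filter.1 hi).2 ?_
    simp only [hh, isolationWeight]
    rw [Finset.prod_eq_zero (i := j) (by simpa using hj) h0, mul_zero]
  -- Two nodes of C within 2R are within ρ by `hC`, where the kernel is zero; then both weights
  -- vanish.
  have hsep : ∀ i ∈ S, ∀ j ∈ S, i ≠ j → 2 * R < dist (X i) (X j) := by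
    intro i hi j hj hij
    by_contra hle
    have := hC _ (hSC i hi) _ (hSC j hj) (not_lt.1 hle)
    refine hSg i hi j hij.symm ?_
    simp only [hg, flipKernel]
    rw [if_pos (by rwa [← dist_eq_norm])]
  set c := Real.exp (-(8 / δ) / 4) / 2 with hc
  have hc0 : 0 < c := by positivity
  have hc1 : c ≤ 1 := by
    have : Real.exp (-(8 / δ) / 4) ≤ 1 := Real.exp_le_one_iff.2 (by
      have : 0 < 8 / δ := by positivity
      linarith)
    simp only [hc]; linarith
  -- Factors beyond R are dropped, being at most 1; within R the kernel is either zero or exactly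
  -- the reduced affinity.
  have hweight : ∀ i ∈ S, h i ≤ ∏ j ∈ A i, max 0 (affinity (linkRate p q φ n X i j 1)
      (linkRate p q φ n X i j (-1)) - δ) := by
    intro i hi
    have e1 : h i ≤ ∏ j ∈ A i, g (X i) (X j) := by
      have hsub : A i ⊆ {i}ᶜ := by
        intro j hj
        simpa using (Finset.mem_filter.1 hj).2.1
      calc h i ≤ ∏ j ∈ {i}ᶜ, g (X i) (X j) :=
            mul_le_of_le_one_left (prod_mem_Icc _ fun j => hgm _ _).1 (indicator_one_mem _ _).2
        _ = (∏ j ∈ {i}ᶜ \ A i, g (X i) (X j)) * ∏ j ∈ A i, g (X i) (X j) :=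
            (Finset.prod_sdiff hsub).symm
        _ ≤ _ := mul_le_of_le_one_left (prod_mem_Icc _ fun j => hgm _ _).1
            (prod_mem_Icc _ fun j => hgm _ _).2
    refine e1.trans (Finset.prod_le_prod (fun j _ => (hgm _ _).1) fun j hj => ?_)
    have hjR := (Finset.mem_filter.1 hj).2.2
    simp only [hg, flipKernel]
    split_ifs
    · exact le_max_left _ _
    · have e2 : affinity (linkRate p q φ n X i j 1) (linkRate p q φ n X i j (-1)) =
          1 - linkInfo p q φ ((n : ℝ) / Real.log n * ‖X i - X j‖) := by
        simp [linkRate, linkInfo, psi, dist_eq_norm]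
      rw [e2]
  -- Separation by more than 2R makes the R-neighbourhoods disjoint and free of other centres;
  -- beyond R the kernel φ vanishes, so those pairs carry no information. The choice K = 8/δ turns
  -- the loss 8/K into δ.
  have hno := sum_no_flip_le (linkRate_comm p q φ n X) (linkRate_mem hp hq hφ n X) S A
    (fun i _ => by simp [hA])
    (fun i hi j hj hij => by
      obtain ⟨hne, hle⟩ := (Finset.mem_filter.1 hij).2
      have := hsep j hj i hi hne.symm
      rw [dist_eq_norm] at this
      linarith)
    (fun i hi j hj hij => by
      rw [Finset.disjoint_left]
      intro k hk hk'
      have h1 := (Finset.mem_filter.1 hk).2.2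
      have h2 := (Finset.mem_filter.1 hk').2.2
      have h3 := hsep i hi j hj hij
      have h4 := dist_triangle_right (X i) (X j) (X k)
      rw [← dist_eq_norm] at h1 h2
      linarith)
    (fun i _ j hji hj => by
      have h1 : R < ‖X i - X j‖ := by
        by_contra hle
        exact hj (Finset.mem_filter.2 ⟨Finset.mem_univ _, hji, not_lt.1 hle⟩)
      have h2 := hκR _ h1
      have h3 : psi φ n (X i) (X j) = 0 := by
        unfold psi
        refine hκ _ ?_
        rw [dist_eq_norm, Real.coe_toNNReal _ (by positivity)]
        exact h2
      simp [linkRate, h3])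
    (K := 8 / δ) (by positivity)
  have e8 : 8 / (8 / δ) = δ := by field_simp
  rw [e8] at hno
  have hfree : rivalFreeProb p q φ n X ≤ ∏ i ∈ S, (1 - c * h i) := by
    refine (rivalFreeProb_le hp hq hφ n X (fun σ G => ∃ i ∈ S,
      graphWeight (linkRate p q φ n X) σ G ≤
        graphWeight (linkRate p q φ n X) (flipLabel σ i) G) ?_).trans ?_
    · rintro σ G ⟨i, -, hi⟩
      exact ⟨_, flipLabel_ne σ i, flipLabel_ne_neg hN σ i, hi⟩
    · refine (mul_le_mul_of_nonneg_left hno (by positivity)).trans ?_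
      rw [← mul_assoc, ← mul_pow, one_div, inv_mul_cancel₀ two_ne_zero, one_pow, one_mul]
      refine Finset.prod_le_prod (fun i _ => ?_) fun i hi => ?_
      · have h1 := prod_mem_Icc (A i) (f := fun j => max 0 (affinity (linkRate p q φ n X i j 1)
            (linkRate p q φ n X i j (-1)) - δ)) fun j => ⟨le_max_left _ _, max_le zero_le_one (by
            have := affinity_le_one (linkRate_mem hp hq hφ n X i j 1)
              (linkRate_mem hp hq hφ n X i j (-1))
            linarith)⟩
        have h2 := mul_le_one₀ hc1 h1.1 h1.2
        simp only [hc] at h2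
        linarith
      · have := mul_le_mul_of_nonneg_left (hweight i hi) hc0.le
        simp only [hc] at this ⊢
        linarith
  have hsum : isolationSum C g X = ∑ i ∈ S, h i := by
    unfold isolationSum
    rw [hS, Finset.sum_filter_ne_zero]
  rw [hsum]
  exact (mul_le_mul_of_nonneg_right hfree (Finset.sum_nonneg fun i _ => (hmem i).1)).trans
    (mul_prod_le_inv S h hc0 hc1 hmem)

end FlipNode


/-! ### The information threshold -/

section Information

variable {p q : ℝ} {φ : ℝ≥0 → ℝ}

theorem eventually_log_pos : ∀ᶠ n : ℕ in atTop, 0 < Real.log n := by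
  filter_upwards [eventually_ge_atTop 2] with n hn
  exact Real.log_pos (by exact_mod_cast hn)

/-- Take the points whose M-th multiple lies within δ/16 of 0, with M about 1/(4R). They form M
short arcs spaced 1/M ≥ 4R apart. Multiplication by M preserves Haar measure, so the total measure
is δ/8 however small R is; this keeps `γ` independent of n. -/
theorem exists_clusters {R δ : ℝ} (hR : 0 < R) (hR4 : R ≤ 1 / 4) (hδ : 0 < δ) (hδ1 : δ ≤ 1) :
    ∃ C : Set Torus, MeasurableSet C ∧ volume.real C = δ / 8 ∧
      ∀ x ∈ C, ∀ y ∈ C, dist x y ≤ 2 * R → dist x y ≤ δ * R := by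
  have h1 : 1 ≤ 1 / (4 * R) := by
    rw [le_div_iff₀ (by positivity)]; linarith
  set M := ⌊1 / (4 * R)⌋₊ with hM
  have hM1 : 1 ≤ M := Nat.one_le_floor_iff _ |>.2 h1
  have hM1' : (1 : ℝ) ≤ M := by exact_mod_cast hM1
  have hM2 : (M : ℝ) ≤ 1 / (4 * R) := Nat.floor_le (by positivity)
  have hM3 : 1 / (4 * R) < M + 1 := Nat.lt_floor_add_one _
  rw [le_div_iff₀ (by positivity)] at hM2
  rw [div_lt_iff₀ (by positivity)] at hM3
  have hmp := measurePreserving_nsmul_torus (M := M) (by omega)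
  refine ⟨(fun z : Torus => M • z) ⁻¹' Metric.closedBall 0 (δ / 16),
    hmp.measurable Metric.isClosed_closedBall.measurableSet, ?_, fun x hx y hy hxy => ?_⟩
  · rw [hmp.measureReal_preimage Metric.isClosed_closedBall.measurableSet.nullMeasurableSet,
      volume_real_closedBall_torus (by positivity), min_eq_right (by linarith)]
    ring
  · have hx' : ‖M • x‖ ≤ δ / 16 := by simpa using hx
    have hy' : ‖M • y‖ ≤ δ / 16 := by simpa using hy
    have h2 : M * dist x y ≤ 1 / 2 := by
      calc M * dist x y ≤ M * (2 * R) := by gcongr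
        _ ≤ 1 / 2 := by linarith
    refine (dist_le_of_nsmul_norm_le hM1 hx' hy' h2).trans ?_
    rw [div_le_iff₀ (by positivity)]
    -- From 1/(4R) < M + 1 ≤ 2M; it makes the arc length δ/(8M) at most δR.
    have h3 : 0 ≤ 8 * (M * R) - 1 := by nlinarith
    have h4 := mul_nonneg hδ.le h3
    linarith

/-- Below the information threshold exact recovery is impossible. -/
theorem not_recoversExactly_of_infoMetric_lt (lam : ℝ≥0) (hlam : 0 < lam)
    (hp : p ∈ Set.Icc (0 : ℝ) 1) (hq : q ∈ Set.Icc (0 : ℝ) 1)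
    (hφ : ∀ x, φ x ∈ Set.Icc (0 : ℝ) 1) (hφm : Measurable φ) {κ : ℝ} (hκ0 : 0 < κ)
    (hκ : ∀ x : ℝ≥0, κ < x → φ x = 0) (h : lam * infoMetric φ p q < 1) (T : ℕ → Estimator) :
    ¬ RecoversExactly lam p q φ T := by
  have hlam' : (0 : ℝ) < lam := hlam
  set I := infoMetric φ p q with hI
  have hI0 : 0 ≤ I := infoMetric_nonneg hp hq hφ
  -- Strictly between I and 1/λ; the bound I + 4κ serves only to have δ ≤ 1.
  obtain ⟨a, haI, ha⟩ : ∃ a, I < a ∧ a < min (1 / (lam : ℝ)) (I + 4 * κ) :=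
    exists_between (lt_min ((lt_div_iff₀ hlam').2 (by linarith)) (by linarith))
  have ha1 : lam * a < 1 := by
    have := (lt_div_iff₀ hlam').1 (ha.trans_le (min_le_left _ _))
    linarith
  have ha2 : a < I + 4 * κ := ha.trans_le (min_le_right _ _)
  -- With ρ = δR and R = κ log n / n, the excess 2ρ + 2δR equals 4κδ log n / n = (a - I) log n / n.
  set δ := (a - I) / (4 * κ) with hδ
  have hδ0 : 0 < δ := div_pos (by linarith) (by positivity)
  have hδ1 : δ ≤ 1 := by rw [hδ, div_le_one (by positivity)]; linarith
  refine not_recoversExactly_of_isolation lam hlam hp hq hφ hφm (a := a) (γ := δ / 8)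
    (D := (Real.exp (-(8 / δ) / 4) / 2)⁻¹) (hI0.trans_lt haI) ha1 (by positivity) ?_ T
  have hR4 : ∀ᶠ n : ℕ in atTop, κ * (Real.log n / n) < 1 / 4 :=
    (tendsto_log_div_natCast κ).eventually_lt_const (by norm_num)
  filter_upwards [hR4, eventually_log_pos, eventually_gt_atTop 0] with n hR4 hlog hn
  have hn' : (0 : ℝ) < n := by exact_mod_cast hn
  set R := κ * (Real.log n / n) with hR
  have hR0 : 0 < R := by positivity
  set s := (n : ℝ) / Real.log n with hs
  have hs0 : 0 < s := by positivity
  obtain ⟨C, hCm, hCv, hC⟩ := exists_clusters hR0 hR4.le hδ0 hδ1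
  have hfk := measurable_flipKernel (p := p) (q := q) hφm s δ (δ * R) R
  refine ⟨C, fun x y => flipKernel p q φ s δ (δ * R) R ‖x - y‖,
    ∫ z : Torus, (1 - flipKernel p q φ s δ (δ * R) R ‖z‖), hCm, ?_,
    fun x y => flipKernel_mem hp hq hφ hδ0.le _ _ _ _, hCv.ge, fun x => ?_, ?_, ?_, ?_⟩
  · exact hfk.comp (measurable_norm.comp (measurable_fst.sub measurable_snd))
  · exact integral_sub_left_eq_self
      (fun z : Torus => 1 - flipKernel p q φ s δ (δ * R) R ‖z‖) volume x
  · refine (integral_one_sub_flipKernel_le hp hq hφ hφm hκ hs0 hδ0.le (by positivity)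
      hR0.le).trans (le_of_eq ?_)
    have e : 4 * κ * δ = a - I := by rw [hδ]; field_simp
    rw [← hI, hs, inv_div, hR]
    linear_combination (Real.log n / n) * e
  -- Points of C with nonzero kernel are more than 2R apart, so z is farther than R from one of
  -- them, where the kernel is 1.
  · intro x hx y hy hxy _ z
    have h1 : 2 * R < dist x y := by
      by_contra hle
      have := hC x hx y hy (not_lt.1 hle)
      rw [dist_eq_norm] at this
      exact hxy (by simp [flipKernel, this])
    have hδR : δ * R ≤ R := mul_le_of_le_one_left hR0.le hδ1
    have far : ∀ w, R < dist w z → flipKernel p q φ s δ (δ * R) R ‖w - z‖ = 1 := by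
      intro w hw
      rw [dist_eq_norm] at hw
      rw [flipKernel, if_neg (by linarith), if_neg (by linarith)]
    have h2 := dist_triangle_right x y z
    beta_reduce
    rcases lt_or_ge R (dist x z) with h3 | h3
    · rw [far x h3]; ring
    · rw [far y (by linarith)]; ring
  · intro N hN X
    refine rivalFreeProb_mul_isolationSum_le hp hq hφ hκ hδ0 hR0.le (fun d hd => ?_) hC hN X
    have := mul_lt_mul_of_pos_left hd hs0
    have e : s * R = κ := by rw [hs, hR]; field_simp
    linarith

end Information

/-! ### The connectivity threshold: gaps on the circle -/

section Gaps

/-- The coordinate of a point of the torus in `[0, 1)`. -/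
noncomputable def coord (z : Torus) : ℝ := AddCircle.equivIco 1 0 z

theorem coord_mem (z : Torus) : coord z ∈ Set.Ico (0 : ℝ) 1 := by
  have := (AddCircle.equivIco (1 : ℝ) 0 z).2
  simpa [coord] using this

theorem coe_coord (z : Torus) : (coord z : Torus) = z :=
  (AddCircle.equivIco (1 : ℝ) 0).symm_apply_apply z

theorem coord_coe {t : ℝ} (h0 : 0 ≤ t) (h1 : t < 1) : coord (t : Torus) = t := by
  have := (AddCircle.equivIco (1 : ℝ) 0).apply_symm_apply ⟨t, by simpa using ⟨h0, h1⟩⟩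
  exact congrArg Subtype.val this

theorem coord_zero : coord 0 = 0 := by
  simpa using coord_coe le_rfl zero_lt_one

theorem measurable_coord : Measurable coord :=
  measurable_subtype_coe.comp (AddCircle.measurableEquivIco (1 : ℝ) 0).measurable

theorem norm_coe_torus_of_mem {t : ℝ} (h0 : 0 ≤ t) (h1 : t < 1) :
    ‖(t : Torus)‖ = min t (1 - t) := by
  rw [UnitAddCircle.norm_eq, abs_sub_round_eq_min, Int.fract_eq_self.2 ⟨h0, h1⟩]

open Classical in
/-- The kernel vanishing on the points at most `L` ahead. -/
noncomputable def gapKernel (L : ℝ) (x y : Torus) : ℝ := if coord (y - x) ≤ L then 0 else 1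

theorem gapKernel_ne_zero {L : ℝ} {x y : Torus} : gapKernel L x y ≠ 0 ↔ L < coord (y - x) := by
  unfold gapKernel
  split_ifs with h
  · simpa using h
  · simpa using h

theorem gapKernel_mem (L : ℝ) (x y : Torus) : gapKernel L x y ∈ Set.Icc (0 : ℝ) 1 := by
  unfold gapKernel; split_ifs <;> simp

theorem measurable_gapKernel (L : ℝ) : Measurable (Function.uncurry (gapKernel L)) := by
  unfold gapKernel
  refine Measurable.ite ?_ measurable_const measurable_const
  exact (measurable_coord.comp (measurable_snd.sub measurable_fst)) measurableSet_Iic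

theorem integral_one_sub_gapKernel {L : ℝ} (h0 : 0 ≤ L) (h1 : L < 1) (x : Torus) :
    ∫ y, (1 - gapKernel L x y) = L := by
  classical
  have e : ∫ y, (1 - gapKernel L x y) = ∫ y, (1 - gapKernel L 0 y) := by
    rw [← integral_sub_right_eq_self (fun y => 1 - gapKernel L 0 y) x]
    simp [gapKernel]
  rw [e, ← UnitAddCircle.integral_preimage 0, zero_add, ← integral_Ico_eq_integral_Ioc]
  have e2 : ∫ t in Set.Ico (0 : ℝ) 1, (1 - gapKernel L 0 (t : Torus)) =
      ∫ t in Set.Ico (0 : ℝ) 1, (Set.Iic L).indicator 1 t := by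
    refine setIntegral_congr_fun measurableSet_Ico fun t ht => ?_
    simp only [gapKernel, sub_zero, coord_coe ht.1 ht.2, Set.indicator_apply, Set.mem_Iic,
      Pi.one_apply]
    split_ifs <;> simp
  rw [e2, setIntegral_indicator measurableSet_Iic]
  have e3 : Set.Ico (0 : ℝ) 1 ∩ Set.Iic L = Set.Icc 0 L := by
    ext t
    simp only [Set.mem_inter_iff, Set.mem_Ico, Set.mem_Iic, Set.mem_Icc]
    constructor
    · rintro ⟨⟨h, -⟩, h'⟩; exact ⟨h, h'⟩
    · rintro ⟨h, h'⟩; exact ⟨⟨h, by linarith⟩, h'⟩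
  rw [e3]
  simp [h0]

/-- If z were within L ahead of both x and y, the nearer of the two to z would lie within L ahead of
the other, contradicting that other point's gap. -/
theorem gapKernel_separated {L : ℝ} {x y : Torus} (hxy : gapKernel L x y ≠ 0)
    (hyx : gapKernel L y x ≠ 0) (z : Torus) :
    (1 - gapKernel L x z) * (1 - gapKernel L y z) = 0 := by
  rw [gapKernel_ne_zero] at hxy hyx
  by_contra hne
  have hu : coord (z - x) ≤ L := by
    by_contra h
    exact hne (by simp [gapKernel, h])
  have hv : coord (z - y) ≤ L := by
    by_contra h
    exact hne (by simp [gapKernel, h])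
  have mu := coord_mem (z - x)
  have mv := coord_mem (z - y)
  rcases le_total (coord (z - y)) (coord (z - x)) with h | h
  · have e : y - x = ((coord (z - x) - coord (z - y) : ℝ) : Torus) := by
      rw [AddCircle.coe_sub, coe_coord, coe_coord]; abel
    rw [e, coord_coe (by linarith) (by linarith [mu.2, mv.1])] at hxy
    linarith [mv.1]
  · have e : x - y = ((coord (z - y) - coord (z - x) : ℝ) : Torus) := by
      rw [AddCircle.coe_sub, coe_coord, coe_coord]; abel
    rw [e, coord_coe (by linarith) (by linarith [mv.2, mu.1])] at hyx
    linarith [mu.1]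

variable {p q : ℝ} {φ : ℝ≥0 → ℝ}

/-- Two nodes each followed by a gap cut the circle into two arcs of nodes that are far apart. -/
theorem exists_cut_of_two_gaps {L : ℝ} (hL : 0 ≤ L) {N : ℕ} (X : Fin N → Torus) {i k : Fin N}
    (hik : i ≠ k) (hi : ∀ j, j ≠ i → L < coord (X j - X i))
    (hk : ∀ j, j ≠ k → L < coord (X j - X k)) :
    ∃ J : Fin N → Prop, J i ∧ ¬ J k ∧ ∀ u v, J u → ¬ J v → L < dist (X u) (X v) := by
  set pos : Fin N → ℝ := fun j => coord (X j - X k) with hpos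
  have hposk : pos k = 0 := by simp [hpos, coord_zero]
  have hmem : ∀ j, pos j ∈ Set.Ico (0 : ℝ) 1 := fun j => coord_mem _
  have hcoe : ∀ j l, X j - X l = ((pos j - pos l : ℝ) : Torus) := by
    intro j l
    rw [AddCircle.coe_sub, coe_coord, coe_coord]; abel
  have hci : L < pos i := hk i hik
  -- With positions measured from k, the side J is the arc after k up to and including i. The gap
  -- after k bounds it on one side, the gap after i on the other.
  refine ⟨fun j => 0 < pos j ∧ pos j ≤ pos i, ⟨by linarith, le_rfl⟩, fun h => h.1.ne' hposk, ?_⟩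
  rintro u v ⟨hu0, hui⟩ hv
  have huk : u ≠ k := fun h => hu0.ne' (h ▸ hposk)
  have hLu : L < pos u := hk u huk
  by_cases hvk : v = k
  · subst hvk
    -- Going forward from i, the node k is reached after distance 1 - pos i, which the gap after i
    -- forces above L.
    have h1 : L < 1 - pos i := by
      have h2 := hi v hik.symm
      have e : X v - X i = ((1 - pos i : ℝ) : Torus) := by
        rw [hcoe, hposk, zero_sub, AddCircle.coe_sub, AddCircle.coe_neg]
        have : ((1 : ℝ) : Torus) = 0 := AddCircle.coe_period 1
        rw [this, zero_sub]
      rwa [e, coord_coe (by linarith [(hmem i).2]) (by linarith)] at h2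
    rw [dist_eq_norm, hcoe, hposk, sub_zero, norm_coe_torus_of_mem (hmem u).1 (hmem u).2]
    exact lt_min hLu (by linarith)
  · have hLv : L < pos v := hk v hvk
    have hvi : pos i < pos v := by
      by_contra hle
      exact hv ⟨by linarith, not_lt.1 hle⟩
    have hvi' : v ≠ i := fun h => hvi.ne (by rw [h])
    have h2 := hi v hvi'
    rw [hcoe, coord_coe (by linarith) (by linarith [(hmem v).2, (hmem i).1])] at h2
    rw [dist_comm, dist_eq_norm, hcoe,
      norm_coe_torus_of_mem (by linarith) (by linarith [(hmem v).2])]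
    exact lt_min (by linarith) (by linarith [(hmem v).2])

/-- Flipping the labels on one side of a cut without links does not change the likelihood. -/
theorem graphWeight_flip_of_cut {N : ℕ} {r : Fin N → Fin N → ℤˣ → ℝ}
    (hsymm : ∀ u v, r u v = r v u) (J : Fin N → Prop) [DecidablePred J]
    (hJ : ∀ u v, J u → ¬ J v → r u v 1 = r u v (-1)) (σ : Fin N → ℤˣ) (G : SimpleGraph (Fin N)) :
    graphWeight r (fun j => if J j then -σ j else σ j) G = graphWeight r σ G := by
  refine Finset.prod_congr rfl fun e _ => ?_
  congr 1
  by_cases h1 : J e.1 <;> by_cases h2 : J e.2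
  · simp [h1, h2]
  · simpa [h1, h2] using apply_neg_of_eq (hJ _ _ h1 h2) (σ e.1 * σ e.2)
  · rw [hsymm e.1 e.2]
    simpa [h1, h2] using apply_neg_of_eq (hJ _ _ h2 h1) (σ e.1 * σ e.2)
  · simp [h1, h2]

theorem rivalFreeProb_mul_gapSum_le (hp : p ∈ Set.Icc (0 : ℝ) 1) (hq : q ∈ Set.Icc (0 : ℝ) 1)
    (hφ : ∀ x, φ x ∈ Set.Icc (0 : ℝ) 1) {n : ℕ} {L : ℝ} (hL : 0 ≤ L)
    (hfar : ∀ x y, L < dist x y → psi φ n x y = 0) {N : ℕ} (X : Fin N → Torus) :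
    rivalFreeProb p q φ n X * isolationSum Set.univ (gapKernel L) X ≤ 1 := by
  classical
  have hmem := fun i => isolationWeight_mem (C := Set.univ) (gapKernel_mem L) X i
  have hgap : ∀ i, isolationWeight Set.univ (gapKernel L) X i ≠ 0 →
      ∀ j, j ≠ i → L < coord (X j - X i) := by
    intro i hi j hj
    rw [← gapKernel_ne_zero]
    intro h0
    refine hi ?_
    rw [isolationWeight, Finset.prod_eq_zero (i := j) (by simpa using hj) h0, mul_zero]
  -- With two gaps there is always a rival, so the rival-free probability is 0; with at most one,
  -- the isolation sum is at most 1.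
  by_cases h : ∃ i k, i ≠ k ∧ isolationWeight Set.univ (gapKernel L) X i ≠ 0 ∧
      isolationWeight Set.univ (gapKernel L) X k ≠ 0
  · obtain ⟨i, k, hik, hi, hk⟩ := h
    obtain ⟨J, hJi, hJk, hJ⟩ := exists_cut_of_two_gaps hL X hik (hgap i hi) (hgap k hk)
    have hle := rivalFreeProb_le hp hq hφ n X (fun _ _ => True) (by
      intro σ G _
      -- Flip one arc. Node i changes and node k does not, so the result is neither the truth nor
      -- its negative.
      refine ⟨fun j => if J j then -σ j else σ j, fun h => ?_, fun h => ?_, ?_⟩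
      · have := congrFun h i
        simp [hJi] at this
      · have := congrFun h k
        simp [hJk] at this
      · refine (graphWeight_flip_of_cut (linkRate_comm p q φ n X) J (fun u v hu hv => ?_) σ G).ge
        simp [linkRate, hfar _ _ (hJ u v hu hv)])
    have h0 : rivalFreeProb p q φ n X = 0 :=
      le_antisymm (by simpa using hle) (rivalFreeProb_nonneg hp hq hφ n X)
    rw [h0, zero_mul]
    exact zero_le_one
  · have hsum : isolationSum Set.univ (gapKernel L) X ≤ 1 := by
      unfold isolationSum
      by_cases hex : ∃ i, isolationWeight Set.univ (gapKernel L) X i ≠ 0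
      · obtain ⟨i, hi⟩ := hex
        rw [Finset.sum_eq_single i]
        · exact (hmem i).2
        · intro k _ hk
          by_contra hk0
          exact h ⟨k, i, hk, hk0, hi⟩
        · simp
      · push Not at hex
        simp [hex]
    exact mul_le_one₀ (rivalFreeProb_le_one hp hq hφ n X)
      (isolationSum_mem (gapKernel_mem L) X).1 hsum

/-- Below the connectivity threshold exact recovery is impossible. -/
theorem not_recoversExactly_of_range_lt (lam : ℝ≥0) (hlam : 0 < lam)
    (hp : p ∈ Set.Icc (0 : ℝ) 1) (hq : q ∈ Set.Icc (0 : ℝ) 1)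
    (hφ : ∀ x, φ x ∈ Set.Icc (0 : ℝ) 1) (hφm : Measurable φ) {κ : ℝ} (hκ0 : 0 < κ)
    (hκ : ∀ x : ℝ≥0, κ < x → φ x = 0) (h : lam * κ < 1) (T : ℕ → Estimator) :
    ¬ RecoversExactly lam p q φ T := by
  refine not_recoversExactly_of_isolation lam hlam hp hq hφ hφm (a := κ) (γ := 1) (D := 1)
    hκ0 h one_pos ?_ T
  have hL1 : ∀ᶠ n : ℕ in atTop, κ * (Real.log n / n) < 1 :=
    (tendsto_log_div_natCast κ).eventually_lt_const (by norm_num)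
  filter_upwards [hL1, eventually_log_pos, eventually_gt_atTop 0] with n hL1 hlog hn
  have hn' : (0 : ℝ) < n := by exact_mod_cast hn
  set L := κ * (Real.log n / n) with hL
  have hL0 : 0 < L := by positivity
  refine ⟨Set.univ, gapKernel L, L, MeasurableSet.univ, measurable_gapKernel L, gapKernel_mem L,
    by simp, integral_one_sub_gapKernel hL0.le hL1, le_rfl,
    fun x _ y _ hxy hyx z => gapKernel_separated hxy hyx z, fun N _ X => ?_⟩
  refine rivalFreeProb_mul_gapSum_le hp hq hφ hL0.le (fun x y hxy => hκ _ ?_) X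
  rw [Real.coe_toNNReal _ (by positivity)]
  have h1 := mul_lt_mul_of_pos_left hxy (by positivity : 0 < (n : ℝ) / Real.log n)
  have e : (n : ℝ) / Real.log n * L = κ := by rw [hL]; field_simp
  linarith

end Gaps

/-! ### The two thresholds combined -/

theorem eq_zero_of_interactionRange_lt {φ : ℝ≥0 → ℝ} (hfin : interactionRange φ < ∞) (x : ℝ≥0)
    (hx : (interactionRange φ).toReal < x) : φ x = 0 := by
  by_contra h
  have h1 : (x : ℝ≥0∞) ≤ interactionRange φ :=
    le_iSup₂ (f := fun (x : ℝ≥0) (_ : x ∈ {x : ℝ≥0 | φ x ≠ 0}) => (x : ℝ≥0∞)) x h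
  have h2 := ENNReal.toReal_mono hfin.ne h1
  rw [ENNReal.coe_toReal] at h2
  linarith

end GKBM

theorem theorem1 (lam : ℝ≥0) (hlam : 0 < lam) (p q : ℝ) (hp : p ∈ Set.Icc (0 : ℝ) 1)
    (hq : q ∈ Set.Icc (0 : ℝ) 1) (φ : ℝ≥0 → ℝ) (hφ_meas : Measurable φ)
    (hφ_mem : ∀ x, φ x ∈ Set.Icc (0 : ℝ) 1) (hκ_pos : 0 < GKBM.interactionRange φ)
    (hκ_fin : GKBM.interactionRange φ < ∞)
    (h : (lam : ℝ≥0∞) * GKBM.interactionRange φ < 1 ∨ (lam : ℝ) * GKBM.infoMetric φ p q < 1) :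
    ¬ ∃ T : ℕ → GKBM.Estimator, GKBM.RecoversExactly lam p q φ T := by
  rintro ⟨T, hT⟩
  have hκ0 : 0 < (GKBM.interactionRange φ).toReal := ENNReal.toReal_pos hκ_pos.ne' hκ_fin.ne
  have hκ := GKBM.eq_zero_of_interactionRange_lt hκ_fin
  rcases h with h | h
  · refine GKBM.not_recoversExactly_of_range_lt lam hlam hp hq hφ_mem hφ_meas hκ0 hκ ?_ T hT
    have h1 := (ENNReal.toReal_lt_toReal h.ne_top ENNReal.one_ne_top).2 h
    simpa using h1
  · exact GKBM.not_recoversExactly_of_infoMetric_lt lam hlam hp hq hφ_mem hφ_meas hκ0 hκ h T hT
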